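/- Let $G$ be the group of real points of a real linear algebraic group, i.e. a Zariski-closed subgroup of some $\mathrm{GL}_n(\mathbb R)$, and assume that $G$ is Zariski-connected. Let $d\ge 2$ and let $\rho:G\to \mathrm{GL}_d(\mathbb R)$ be a faithful irreducible rational representation; through $\rho$ we regard the elements of $G$ as matrices in $\mathrm{GL}_d(\mathbb R)$ acting on $\mathbb P=\mathbb P(\mathbb R^d)$. Call $g\in \mathrm{GL}_d(\mathbb R)$ *regular* if either $g$ is regular unipotent (unipotent with a single Jordan block), or the $d$ complex eigenvalues of $g$, counted with multiplicity, have pairwise distinct absolute values. For a regular $g$ let $v_g\in\mathbb P$ and $H_g\subset\mathbb P$ be its attracting point and repelling hyperplane: the projective transformations induced by $g^m$ converge, as $m\to\infty$, to the rank-one projective map with image $v_g$ and kernel $H_g$. An incident pair is a pair $(v,H)$ of a point and a hyperplane of $\mathbb P$ with $v\in H$; it is *$G$-defined* if there is a regular $g\in G$ with $v=v_g$ and $H=H_{g^{-1}}$. Assume that the set of $G$-defined incident pairs is not contained in a proper subvariety of the variety of all incident pairs (a subvariety being the set of incident pairs at which a family of real bihomogeneous polynomials in the coordinates of $v$ and $H$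 vanishes). Let $\Gamma\le G$ be a lattice (a discrete subgroup such that $G/\Gamma$ carries a $G$-invariant Borel probability measure), every nontrivial element of which is regular. Then $\Gamma$ has a free subgroup of infinite rank which meets every conjugacy class of $\Gamma$. Moreover, $\Gamma$ is not invariably generated, i.e. for every subset $S\subseteq\Gamma$ there is a choice of elements $c(s)\in\Gamma$, $s\in S$, such that $\{c(s)^{-1}s\,c(s): s\in S\}$ does not generate $\Gamma$. -/

import Mathlib

open scoped LinearAlgebra.Projectivization

/-! ### Real linear algebraic groups and their rational representations -/

/-- The Zariski closed subsets of `GL_n(ℝ)`: common zero loci of polynomials in the entries. -/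
def IsZariskiClosed {n : ℕ} (S : Set (GL (Fin n) ℝ)) : Prop :=
  ∃ F : Set (MvPolynomial (Fin n × Fin n) ℝ),
    S = {g | ∀ f ∈ F, MvPolynomial.eval (fun ij => g.val ij.1 ij.2) f = 0}

/-- A nonempty subset of `GL_n(ℝ)` is Zariski connected if it is not the union of two disjoint
nonempty relatively Zariski closed subsets. -/
def IsZariskiConnected {n : ℕ} (S : Set (GL (Fin n) ℝ)) : Prop :=
  S.Nonempty ∧ ∀ A B : Set (GL (Fin n) ℝ), IsZariskiClosed A → IsZariskiClosed B →
    S ⊆ A ∪ B → S ∩ (A ∩ B) = ∅ → S ⊆ A ∨ S ⊆ B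

/-- A representation `G → GL_d(ℝ)` is rational (a morphism of real algebraic groups) if its matrix
entries are regular functions on `G`, i.e. polynomials in the entries of `g` and `(det g)⁻¹`. -/
def IsRationalRep {n d : ℕ} (G : Subgroup (GL (Fin n) ℝ)) (ρ : G →* GL (Fin d) ℝ) : Prop :=
  ∃ (P : Fin d → Fin d → MvPolynomial (Fin n × Fin n) ℝ) (k : ℕ), ∀ (g : G) (i j : Fin d),
    (ρ g).val i j =
      MvPolynomial.eval (fun ij => g.val.val ij.1 ij.2) (P i j) * (g.val.val.det)⁻¹ ^ k

/-- The linear representation on `ℝ^d` given by a homomorphism to `GL_d(ℝ)`. -/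
def linearRep {G : Type*} [Group G] {d : ℕ} (ρ : G →* GL (Fin d) ℝ) :
    Representation ℝ G (Fin d → ℝ) where
  toFun g := Matrix.toLin' (ρ g).val
  map_one' := by simp [Module.End.one_eq_id]
  map_mul' g h := by simp [Matrix.toLin'_mul, Module.End.mul_eq_comp]

/-! ### Regular elements, attracting points and repelling hyperplanes -/

/-- A regular unipotent matrix: `A - 1` is nilpotent of maximal order, i.e. `A` is unipotent with a
single Jordan block. -/
def IsRegularUnipotent {d : ℕ} (A : Matrix (Fin d) (Fin d) ℝ) : Prop :=
  IsNilpotent (A - 1) ∧ (A - 1) ^ (d - 1) ≠ 0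

/-- All complex eigenvalues, counted with multiplicity, have distinct absolute values. -/
def HasDistinctAbsEigenvalues {d : ℕ} (A : Matrix (Fin d) (Fin d) ℝ) : Prop :=
  ((A.charpoly.aroots ℂ).map (fun z => ‖z‖)).Nodup

/-- Regular elements of `GL_d(ℝ)`. -/
def IsRegularElt {d : ℕ} (g : GL (Fin d) ℝ) : Prop :=
  IsRegularUnipotent g.val ∨ HasDistinctAbsEigenvalues g.val

/-- Points of `ℙ(ℝ^d)` are denoted by `x`, and `y : ℙ(ℝ^d)` also stands for the hyperplane
`{w | y ⬝ w = 0}`. The pair `(x, y)` is the attracting point and repelling hyperplane of `g` if,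
as projective transformations, the positive powers `g ^ n` converge to the rank one
map with image `x` and kernel `y`; in particular `g ^ n` tends to `x` uniformly on compact subsets
of the complement of `y`. Limits in the projective space of matrices are unique, hence so are `x`
and `y`. For `g` with eigenvalues of distinct absolute values, `x` is the eigenline of the largest
one and `y` the span of the other eigenlines; for `g` regular unipotent, `x` is the kernel and `y`
the range of `g - 1`. -/
def HasAttractingRepelling {d : ℕ} (g : GL (Fin d) ℝ) (x y : ℙ ℝ (Fin d → ℝ)) : Prop :=
  ∃ c : ℕ → ℝ, Filter.Tendsto (fun n => c n • g.val ^ n) Filter.atTop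
    (nhds (Matrix.vecMulVec x.rep y.rep))

/-- `x` is the attracting point `v_g` of `g`. -/
def IsAttractingPoint {d : ℕ} (g : GL (Fin d) ℝ) (x : ℙ ℝ (Fin d → ℝ)) : Prop :=
  ∃ y, HasAttractingRepelling g x y

/-- `y` is the repelling hyperplane `H_g` of `g`. -/
def IsRepellingHyperplane {d : ℕ} (g : GL (Fin d) ℝ) (y : ℙ ℝ (Fin d → ℝ)) : Prop :=
  ∃ x, HasAttractingRepelling g x y

/-! ### Incident pairs -/

/-- The set of incident pairs (point, hyperplane), the point lying on the hyperplane. -/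
def incidentPairs (d : ℕ) : Set (ℙ ℝ (Fin d → ℝ) × ℙ ℝ (Fin d → ℝ)) :=
  {p | Projectivization.orthogonal p.2 p.1}

/-- The incident pairs of the form `(v_g, H_{g⁻¹})` with `g ∈ G` regular. -/
def definedIncidentPairs {d : ℕ} (G : Subgroup (GL (Fin d) ℝ)) :
    Set (ℙ ℝ (Fin d → ℝ) × ℙ ℝ (Fin d → ℝ)) :=
  {p | p ∈ incidentPairs d ∧
    ∃ g ∈ G, IsRegularElt g ∧ IsAttractingPoint g p.1 ∧ IsRepellingHyperplane g⁻¹ p.2}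

/-- `f` is bihomogeneous in the coordinates of the point and in those of the hyperplane. -/
def IsBihomogeneous {d : ℕ} (f : MvPolynomial (Fin d ⊕ Fin d) ℝ) : Prop :=
  ∃ m : ℕ × ℕ, MvPolynomial.IsWeightedHomogeneous
    (Sum.elim (fun _ => ((1, 0) : ℕ × ℕ)) (fun _ => ((0, 1) : ℕ × ℕ))) f m

/-- A (real) subvariety of the set of incident pairs: the incident pairs at which all members of a
family of bihomogeneous polynomials vanish. (The choice of representatives is immaterial.) -/
def IsIncidentSubvariety {d : ℕ} (X : Set (ℙ ℝ (Fin d → ℝ) × ℙ ℝ (Fin d → ℝ))) : Prop :=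
  ∃ F : Set (MvPolynomial (Fin d ⊕ Fin d) ℝ), (∀ f ∈ F, IsBihomogeneous f) ∧
    X = {p | p ∈ incidentPairs d ∧
      ∀ f ∈ F, MvPolynomial.eval (Sum.elim p.1.rep p.2.rep) f = 0}

/-! ### Lattices and invariable generation -/

/-- A lattice: a discrete subgroup `Γ` such that `G ⧸ Γ` carries a `G`-invariant Borel probability
measure. -/
def IsLatticeSubgroup {G : Type*} [Group G] [TopologicalSpace G] (Γ : Subgroup G) : Prop :=
  DiscreteTopology Γ ∧
    ∃ μ : @MeasureTheory.Measure (G ⧸ Γ) (borel (G ⧸ Γ)),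
      @MeasureTheory.IsProbabilityMeasure _ (borel (G ⧸ Γ)) μ ∧
      ∀ g : G, @MeasureTheory.Measure.map _ _ (borel (G ⧸ Γ)) (borel (G ⧸ Γ))
        (fun x : G ⧸ Γ => g • x) μ = μ

/-- `S` invariably generates `Γ`: any choice of conjugates of the elements of `S` generates. -/
def InvariablyGenerates {Γ : Type*} [Group Γ] (S : Set Γ) : Prop :=
  ∀ c : Γ → Γ, Subgroup.closure ((fun s => (c s)⁻¹ * s * c s) '' S) = ⊤

/-- `Γ` is invariably generated (IG). -/
def IsInvariablyGenerated (Γ : Type*) [Group Γ] : Prop :=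
  ∃ S : Set Γ, InvariablyGenerates S

/-!
The free subgroup is generated by conjugates of all the nontrivial elements of `Γ` that play
ping-pong on the projective space.

Call a pair `(x, y)` of a vector and a functional *`G`-defined* if it represents `(v_g, H_{g⁻¹})`
for some `g ∈ G` which, together with its inverse, has an attracting point and a repelling
hyperplane (`IsAttractingData`). If `γ` is such that no nontrivial power of `γ`, and neither of the
projective limits of `γ ^ k` as `k → ±∞`, maps the point `v_{g⁻¹}` into the hyperplane `H_g`, then
`g ^ m γ ^ k g ^ (-m)` is for large `m` projectively close to `x yᵀ`, uniformly in `k ≠ 0`. Poincaré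
recurrence on `G ⧸ Γ` (`IsLatticeSubgroup.exists_pow_mem`) allows replacing `g ^ m` by an element of
`Γ` (`IsAttractingData.exists_conj_mem`).

That `g` can be chosen in this way is a matter of general position. A Zariski connected group is
irreducible, so finitely many regular functions that do not vanish identically have a common point
of nonvanishing (`exists_forall_ne_zero_of_regularFunctions`). For a matrix `M` that is not scalar,
`a ↦ y · ρ(a)⁻¹ M ρ(a) x` does not vanish identically: the `G`-orbit of `(x, y)` accumulates at
every `G`-defined incident pair, and these pairs do not all satisfy the bilinear equation
`y · M x = 0` (`exists_dotProduct_conj_mulVec_ne_zero`). As infinitely many powers of `γ` are involved, the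
conjugation is done in two steps. The limits of `γ ^ k` take care of all but finitely many powers.
For the remaining ones the conjugating element is taken from a finite set chosen in advance, which
detects the nonvanishing of products of a bounded number of the functions above
(`ContractsTo.exists_one`). As a result, for every nontrivial `γ ∈ Γ` and every `G`-defined incident
pair `(x, y)`, some conjugate of `γ` has all its nontrivial powers close to `x yᵀ`
(`IsAttractingData.contractsTo`).

Translating one `G`-defined incident pair in general position by powers of a fixed `g` gives a
convergent sequence of pairs `(xᵢ, yᵢ)` with `yᵢ · xᵢ = 0` and `yᵢ · xⱼ ≠ 0` for `i ≠ j`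
(`IsAttractingData.exists_sequence`). Conjugating the `i`-th nontrivial element of the countable
group `Γ` close to `xᵢ yᵢᵀ` gives free generators (`exists_injective_lift_of_contracting`). With one
generator left out, the subgroup they generate is proper and still meets all conjugacy classes, so
`Γ` is not invariably generated.
-/

open Topology Filter Matrix

/-! ### Zariski connected linear groups are irreducible -/

section

/-- In a Noetherian space with a transitive group of homeomorphisms every point lies on a single
irreducible component, so the irreducible components are open. -/
theorem isPreirreducible_univ_of_continuous_mul_left {H : Type*} [Group H] [TopologicalSpace H]
    [TopologicalSpace.NoetherianSpace H] [PreconnectedSpace H]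
    (hmul : ∀ g : H, Continuous fun x : H => g * x) : IsPreirreducible (Set.univ : Set H) := by
  obtain ⟨Z, hZ⟩ : (irreducibleComponents H).Nonempty :=
    ⟨irreducibleComponent 1, irreducibleComponent_mem_irreducibleComponents 1⟩
  obtain ⟨o, ho, ⟨p, hp⟩, hoZ⟩ :=
    TopologicalSpace.NoetherianSpace.exists_isOpen_nonempty_subset_irreducibleComponent Z hZ
  have hZopen : IsOpen Z := by
    rw [isOpen_iff_mem_nhds]
    intro z hz
    -- the translate of `o` by `g = z * p⁻¹` is an irreducible neighbourhood of `z`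
    have ho' : IsOpen ((fun x => (p * z⁻¹) * x) ⁻¹' o) := ho.preimage (hmul _)
    have hW : IsIrreducible ((fun x => (z * p⁻¹) * x) '' Z) :=
      hZ.1.image _ (hmul _).continuousOn
    have hoW : (fun x => (p * z⁻¹) * x) ⁻¹' o ⊆ (fun x => (z * p⁻¹) * x) '' Z := by
      intro x hx
      exact ⟨_, hoZ hx, by group⟩
    have hzo : z ∈ (fun x => (p * z⁻¹) * x) ⁻¹' o := by simpa using hp
    have h1 : Z ⊆ closure ((fun x => (z * p⁻¹) * x) '' Z) :=
      (subset_closure_inter_of_isPreirreducible_of_isOpen hZ.1.2 ho' ⟨z, hz, hzo⟩).trans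
        (closure_mono (Set.inter_subset_right.trans hoW))
    have h2 := hZ.2 hW.closure h1
    exact Filter.mem_of_superset (ho'.mem_nhds hzo) (hoW.trans (subset_closure.trans h2))
  have : Z = Set.univ :=
    IsClopen.eq_univ ⟨isClosed_of_mem_irreducibleComponents Z hZ, hZopen⟩ hZ.1.1
  exact this ▸ hZ.1.2

variable {n : ℕ}

/-- The algebra of regular functions on `G`: the polynomials in the matrix entries and in the
inverse of the determinant. -/
def regularFunctions (G : Subgroup (GL (Fin n) ℝ)) : Subalgebra ℝ (G → ℝ) where
  carrier := {f | ∃ (q : MvPolynomial (Fin n × Fin n) ℝ) (k : ℕ), ∀ g : G,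
    f g = MvPolynomial.eval (fun ij => g.val.val ij.1 ij.2) q * (g.val.val.det)⁻¹ ^ k}
  mul_mem' := by
    rintro f h ⟨q, k, hq⟩ ⟨r, l, hr⟩
    exact ⟨q * r, k + l, fun g => by simp only [Pi.mul_apply, hq, hr, map_mul]; ring⟩
  add_mem' := by
    rintro f h ⟨q, k, hq⟩ ⟨r, l, hr⟩
    let D : MvPolynomial (Fin n × Fin n) ℝ :=
      (Matrix.of fun i j => MvPolynomial.X (i, j) : Matrix (Fin n) (Fin n) _).det
    have hD : ∀ g : G, MvPolynomial.eval (fun ij => g.val.val ij.1 ij.2) D = g.val.val.det := by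
      intro g
      simp only [D, RingHom.map_det]
      congr 1
      ext i j
      simp
    refine ⟨q * D ^ l + r * D ^ k, k + l, fun g => ?_⟩
    have h0 : g.val.val.det ≠ 0 := (Matrix.isUnit_iff_isUnit_det _).1 g.val.isUnit |>.ne_zero
    simp only [Pi.add_apply, hq, hr, map_mul, map_add, map_pow, hD]
    rw [pow_add, inv_pow, inv_pow]
    field_simp
  algebraMap_mem' r := ⟨MvPolynomial.C r, 0, fun g => by simp⟩

variable {G : Subgroup (GL (Fin n) ℝ)}

theorem entry_mem_regularFunctions (i j : Fin n) :
    (fun g : G => g.val.val i j) ∈ regularFunctions G :=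
  ⟨MvPolynomial.X (i, j), 0, fun g => by simp⟩

theorem inv_det_mem_regularFunctions :
    (fun g : G => (g.val.val.det)⁻¹) ∈ regularFunctions G :=
  ⟨1, 1, fun g => by simp⟩

theorem det_mem_subalgebra {X : Type*} (R : Subalgebra ℝ (X → ℝ)) {m : ℕ}
    (A : X → Matrix (Fin m) (Fin m) ℝ) (hA : ∀ i j, (fun x => A x i j) ∈ R) :
    (fun x => (A x).det) ∈ R := by
  have : (fun x => (A x).det) =
      ∑ σ : Equiv.Perm (Fin m), ((Equiv.Perm.sign σ : ℤ) : ℝ) • ∏ i, fun x => A x (σ i) i := by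
    funext x
    simp [Matrix.det_apply', Finset.sum_apply, Finset.prod_apply]
  rw [this]
  exact R.sum_mem fun σ _ => R.smul_mem (R.prod_mem fun i _ => hA _ _) _

theorem eval_mem_subalgebra {X σ : Type*} (R : Subalgebra ℝ (X → ℝ)) (u : X → σ → ℝ)
    (hu : ∀ i, (fun x => u x i) ∈ R) (q : MvPolynomial σ ℝ) :
    (fun x => MvPolynomial.eval (u x) q) ∈ R := by
  induction q using MvPolynomial.induction_on with
  | C a => simp only [MvPolynomial.eval_C]; exact R.algebraMap_mem a
  | add p q hp hq => simp only [map_add]; exact R.add_mem hp hq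
  | mul_X p i hp => simp only [map_mul, MvPolynomial.eval_X]; exact R.mul_mem hp (hu i)

theorem comp_inv_mem_regularFunctions {f : G → ℝ} (hf : f ∈ regularFunctions G) :
    (fun g => f g⁻¹) ∈ regularFunctions G := by
  obtain ⟨q, k, hq⟩ := hf
  have hinv : ∀ g : G, (g⁻¹).val.val = (g.val.val.det)⁻¹ • g.val.val.adjugate := by
    intro g
    simp [Matrix.coe_units_inv, Matrix.inv_def]
  have hadj : ∀ i j, (fun g : G => g.val.val.adjugate i j) ∈ regularFunctions G := by
    intro i j
    simp only [Matrix.adjugate_apply]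
    refine det_mem_subalgebra _ _ fun a b => ?_
    by_cases h : a = j
    · subst h
      simp only [Matrix.updateRow_self]
      exact (regularFunctions G).algebraMap_mem ((Pi.single i 1 : Fin n → ℝ) b)
    · simpa [Matrix.updateRow_ne h] using entry_mem_regularFunctions a b
  have hent : ∀ ij : Fin n × Fin n,
      (fun g : G => (g⁻¹).val.val ij.1 ij.2) ∈ regularFunctions G := by
    intro ij
    simp only [hinv, Matrix.smul_apply, smul_eq_mul]
    exact mul_mem inv_det_mem_regularFunctions (hadj _ _)
  simp only [hq]
  refine mul_mem (eval_mem_subalgebra _ _ hent q) (pow_mem (S := regularFunctions G)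
    (x := fun g : G => ((g⁻¹).val.val.det)⁻¹) ?_ k)
  have : (fun g : G => ((g⁻¹).val.val.det)⁻¹) = fun g : G => g.val.val.det := by
    funext g
    simp [Matrix.coe_units_inv, Matrix.det_nonsing_inv]
  rw [this]
  exact det_mem_subalgebra _ _ fun a b => entry_mem_regularFunctions a b

/-- The point of the prime spectrum of the polynomial ring given by an element of `G`: the kernel of
evaluation at its matrix entries. -/
noncomputable def evalPoint (g : G) : PrimeSpectrum (MvPolynomial (Fin n × Fin n) ℝ) :=
  ⟨RingHom.ker (MvPolynomial.eval fun ij => g.val.val ij.1 ij.2), RingHom.ker_isPrime _⟩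

/-- The Zariski topology on `G`, with the common zero loci in `G` of polynomials in the matrix
entries as closed sets. It is not the topology that `G` carries as an instance. -/
@[reducible]
noncomputable def zariskiTopology (G : Subgroup (GL (Fin n) ℝ)) : TopologicalSpace G :=
  TopologicalSpace.induced evalPoint inferInstance

theorem isClosed_zariskiTopology_iff (A : Set G) :
    IsClosed[zariskiTopology G] A ↔
      ∃ Z : Set (GL (Fin n) ℝ), IsZariskiClosed Z ∧ Subtype.val ⁻¹' Z = A := by
  rw [zariskiTopology, isClosed_induced_iff]
  constructor
  · rintro ⟨t, ht, rfl⟩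
    obtain ⟨F, rfl⟩ := (PrimeSpectrum.isClosed_iff_zeroLocus t).1 ht
    exact ⟨_, ⟨F, rfl⟩, by ext g; simp [evalPoint, PrimeSpectrum.mem_zeroLocus, Set.subset_def]⟩
  · rintro ⟨Z, ⟨F, rfl⟩, rfl⟩
    exact ⟨_, PrimeSpectrum.isClosed_zeroLocus F,
      by ext g; simp [evalPoint, PrimeSpectrum.mem_zeroLocus, Set.subset_def]⟩

theorem isClosed_zeros_of_mem_regularFunctions {f : G → ℝ} (hf : f ∈ regularFunctions G) :
    IsClosed[zariskiTopology G] {g | f g = 0} := by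
  obtain ⟨q, k, hq⟩ := hf
  refine (isClosed_zariskiTopology_iff _).2 ⟨_, ⟨{q}, rfl⟩, ?_⟩
  ext g
  have h0 : g.val.val.det ≠ 0 := (Matrix.isUnit_iff_isUnit_det _).1 g.val.isUnit |>.ne_zero
  simp [hq, h0]

theorem isPreirreducible_zariskiTopology (hG : IsZariskiConnected (G : Set (GL (Fin n) ℝ))) :
    @IsPreirreducible G (zariskiTopology G) Set.univ := by
  let : TopologicalSpace G := zariskiTopology G
  have : TopologicalSpace.NoetherianSpace G :=
    Topology.IsInducing.noetherianSpace (i := evalPoint (G := G)) ⟨rfl⟩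
  have : PreconnectedSpace G := by
    refine ⟨isPreconnected_closed_iff.2 fun A B hA hB hAB ⟨a, ha⟩ ⟨b, hb⟩ => ?_⟩
    obtain ⟨A', hA', rfl⟩ := (isClosed_zariskiTopology_iff A).1 hA
    obtain ⟨B', hB', rfl⟩ := (isClosed_zariskiTopology_iff B).1 hB
    by_contra hne
    have hdisj : ∀ g : G, g.val ∈ A' → g.val ∈ B' → False := fun g h1 h2 =>
      hne ⟨g, trivial, h1, h2⟩
    rcases hG.2 A' B' hA' hB' (fun g hg => hAB (Set.mem_univ (⟨g, hg⟩ : G)))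
      (Set.eq_empty_of_forall_notMem fun g hg => hdisj ⟨g, hg.1⟩ hg.2.1 hg.2.2) with h | h
    · exact hdisj b (h b.2) hb.2
    · exact hdisj a ha.2 (h a.2)
  refine isPreirreducible_univ_of_continuous_mul_left fun g => ?_
  refine continuous_iff_isClosed.2 fun A hA => ?_
  obtain ⟨A', ⟨F, rfl⟩, rfl⟩ := (isClosed_zariskiTopology_iff A).1 hA
  have : (fun x => g * x) ⁻¹' (Subtype.val ⁻¹' {g : GL (Fin n) ℝ | ∀ f ∈ F,
      MvPolynomial.eval (fun ij => g.val ij.1 ij.2) f = 0}) =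
      ⋂ f ∈ F, {x : G | MvPolynomial.eval (fun ij => (g * x).val.val ij.1 ij.2) f = 0} := by
    ext x
    simp
  rw [this]
  refine isClosed_biInter fun f _ => isClosed_zeros_of_mem_regularFunctions ?_
  refine eval_mem_subalgebra _ _ (fun ij => ?_) f
  have : (fun x : G => (g * x).val.val ij.1 ij.2) =
      ∑ k, (g.val.val ij.1 k) • fun x : G => x.val.val k ij.2 := by
    funext x
    simp [Matrix.mul_apply, Finset.sum_apply]
  rw [this]
  exact sum_mem fun k _ => (regularFunctions G).smul_mem (entry_mem_regularFunctions _ _) _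

/-- Finitely many regular functions, none of which vanishes identically on a Zariski connected
group, have a common point of nonvanishing. -/
theorem exists_forall_ne_zero_of_regularFunctions
    (hG : IsZariskiConnected (G : Set (GL (Fin n) ℝ))) {ι : Type*} (s : Finset ι)
    (f : ι → G → ℝ) (hf : ∀ i ∈ s, f i ∈ regularFunctions G) (h : ∀ i ∈ s, ∃ a, f i a ≠ 0) :
    ∃ a, ∀ i ∈ s, f i a ≠ 0 := by
  classical
  suffices ∃ a, (∏ i ∈ s, f i) a ≠ 0 by
    obtain ⟨a, ha⟩ := this
    exact ⟨a, by simpa [Finset.prod_apply, Finset.prod_ne_zero_iff] using ha⟩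
  induction s using Finset.induction_on with
  | empty => exact ⟨1, by simp⟩
  | insert i s his ih =>
    obtain ⟨a, ha⟩ := h i (by simp)
    obtain ⟨b, hb⟩ := ih (fun j hj => hf j (by simp [hj])) (fun j hj => h j (by simp [hj]))
    have h1 := isClosed_zeros_of_mem_regularFunctions (hf i (by simp))
    have h2 := isClosed_zeros_of_mem_regularFunctions
      ((regularFunctions G).prod_mem fun j hj => hf j (Finset.mem_insert_of_mem hj))
    let : TopologicalSpace G := zariskiTopology G
    obtain ⟨c, -, hc1, hc2⟩ := isPreirreducible_zariskiTopology hG _ _ h1.isOpen_compl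
      h2.isOpen_compl ⟨a, trivial, ha⟩ ⟨b, trivial, fun h0 => hb (by simpa using h0)⟩
    refine ⟨c, ?_⟩
    rw [Finset.prod_insert his]
    exact mul_ne_zero hc1 fun h0 => hc2 (by simpa using h0)

theorem rationalRep_entry_mem_regularFunctions {d : ℕ} {ρ : G →* GL (Fin d) ℝ}
    (hρ : IsRationalRep G ρ) (i j : Fin d) :
    (fun g => (ρ g).val i j) ∈ regularFunctions G := by
  obtain ⟨P, k, hP⟩ := hρ
  exact ⟨P i j, k, fun g => hP g i j⟩

/-- In a finite dimensional space of functions, a function is determined by its values on a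
suitable finite set. -/
theorem exists_finset_determining {X : Type*} (W : Submodule ℝ (X → ℝ)) (hW : W.FG) :
    ∃ S : Finset X, ∀ f ∈ W, (∀ x ∈ S, f x = 0) → f = 0 := by
  have : IsArtinian ℝ W := by
    have : Module.Finite ℝ W := Module.Finite.iff_fg.2 hW
    infer_instance
  obtain ⟨S, hS⟩ := Finset.exists_inf_le
    fun x : X => LinearMap.ker ((LinearMap.proj (R := ℝ) (φ := fun _ : X => ℝ) x).comp W.subtype)
  refine ⟨S, fun f hf h => funext fun x => ?_⟩
  have : (⟨f, hf⟩ : W) ∈ S.inf fun x : X =>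
      LinearMap.ker ((LinearMap.proj (R := ℝ) (φ := fun _ : X => ℝ) x).comp W.subtype) := by
    simpa [Submodule.mem_finsetInf] using h
  simpa using hS x this

end

/-! ### Recurrence on the quotient by a lattice -/

section

/-- Poincaré recurrence on `G ⧸ Γ`: up to errors in a neighbourhood of the identity, arbitrarily
large powers of any `g` belong to the lattice `Γ`. -/
theorem IsLatticeSubgroup.exists_pow_mem {G : Type*} [Group G] [TopologicalSpace G]
    [IsTopologicalGroup G] [SecondCountableTopology G] {Γ : Subgroup G} (hΓ : IsLatticeSubgroup Γ)
    (g : G) (N : ℕ) {U : Set G} (hU : U ∈ 𝓝 (1 : G)) :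
    ∃ m ≥ N, ∃ u ∈ U, ∃ u' ∈ U, u⁻¹ * g ^ m * u' ∈ Γ := by
  obtain ⟨-, μ, hμ, hinv⟩ := hΓ
  let : MeasurableSpace (G ⧸ Γ) := borel (G ⧸ Γ)
  have : BorelSpace (G ⧸ Γ) := ⟨rfl⟩
  have hmp : ∀ a : G, MeasureTheory.MeasurePreserving (fun x : G ⧸ Γ => a • x) μ μ := fun a =>
    ⟨(continuous_const_smul a).measurable, hinv a⟩
  let V : Set (G ⧸ Γ) := QuotientGroup.mk '' interior U
  have hV : IsOpen V := QuotientGroup.isOpenMap_coe _ isOpen_interior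
  have hV0 : μ V ≠ 0 := by
    intro h0
    -- countably many translates of `interior U` cover `G`
    obtain ⟨T, hT, hTU⟩ := TopologicalSpace.isOpen_iUnion_countable
      (fun a : G => (fun x => a⁻¹ * x) ⁻¹' interior U)
      fun a => isOpen_interior.preimage (continuous_const_mul a⁻¹)
    have hcover : (Set.univ : Set (G ⧸ Γ)) ⊆ ⋃ a ∈ T, (fun x => a⁻¹ • x) ⁻¹' V := by
      intro q _
      obtain ⟨b, rfl⟩ := QuotientGroup.mk_surjective q
      have hb : b ∈ ⋃ a : G, (fun x => a⁻¹ * x) ⁻¹' interior U :=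
        Set.mem_iUnion.2 ⟨b, by simpa using mem_interior_iff_mem_nhds.2 hU⟩
      rw [← hTU] at hb
      simp only [Set.mem_iUnion] at hb ⊢
      obtain ⟨a, ha, hab⟩ := hb
      exact ⟨a, ha, _, hab, rfl⟩
    have hzero : μ (⋃ a ∈ T, (fun x => a⁻¹ • x) ⁻¹' V) = 0 := by
      rw [MeasureTheory.measure_biUnion_null_iff hT]
      intro a _
      rw [(hmp a⁻¹).measure_preimage hV.measurableSet.nullMeasurableSet, h0]
    have h1 := MeasureTheory.measure_mono_null hcover hzero
    simp at h1
  obtain ⟨q, ⟨u', hu', rfl⟩, m, hm, u, hu, hum⟩ :=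
    (hmp (g ^ N)).exists_mem_iterate_mem hV.measurableSet.nullMeasurableSet hV0
  refine ⟨N * m, Nat.le_mul_of_pos_right _ (Nat.pos_of_ne_zero hm), u, interior_subset hu, u',
    interior_subset hu', ?_⟩
  rw [smul_iterate, ← pow_mul] at hum
  have h2 : (u : G ⧸ Γ) = ((g ^ (N * m) * u' : G) : G ⧸ Γ) := hum
  rw [QuotientGroup.eq] at h2
  simpa [mul_assoc] using h2

/-! ### Attracting points and repelling hyperplanes -/

variable {n d : ℕ} {G : Subgroup (GL (Fin n) ℝ)}

theorem continuous_of_mem_regularFunctions {f : G → ℝ} (hf : f ∈ regularFunctions G) :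
    Continuous f := by
  obtain ⟨q, k, hq⟩ := hf
  have hval : Continuous fun g : G => g.val.val := Units.continuous_val.comp continuous_subtype_val
  rw [show f = _ from funext hq]
  refine Continuous.mul ((MvPolynomial.continuous_eval q).comp
    (continuous_pi fun ij => hval.matrix_elem ij.1 ij.2)) (Continuous.pow ?_ k)
  exact hval.matrix_det.inv₀ fun g =>
    ((Matrix.isUnit_iff_isUnit_det _).1 g.val.isUnit).ne_zero

theorem IsRationalRep.continuous {ρ : G →* GL (Fin d) ℝ} (hρ : IsRationalRep G ρ) :
    Continuous fun g => (ρ g).val :=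
  continuous_matrix fun i j =>
    continuous_of_mem_regularFunctions (rationalRep_entry_mem_regularFunctions hρ i j)

instance secondCountableTopology_subgroup_GL : SecondCountableTopology G := by
  have : SecondCountableTopology (Matrix (Fin n) (Fin n) ℝ) :=
    inferInstanceAs (SecondCountableTopology (Fin n → Fin n → ℝ))
  have : SecondCountableTopology (Matrix (Fin n) (Fin n) ℝ)ᵐᵒᵖ :=
    MulOpposite.opHomeomorph.symm.isEmbedding.secondCountableTopology
  have : SecondCountableTopology (GL (Fin n) ℝ) :=
    Units.isEmbedding_embedProduct.secondCountableTopology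
  exact TopologicalSpace.Subtype.secondCountableTopology _

/-- Vectors `x`, `x'` and functionals `y'`, `y` representing the attracting points `v_g = [x]`,
`v_{g⁻¹} = [x']` and the repelling hyperplanes `H_g = ker y'`, `H_{g⁻¹} = ker y`, in the case where
`v_g` lies on `H_{g⁻¹}`. -/
structure IsAttractingData (ρ : G →* GL (Fin d) ℝ) (g : G) (x y' x' y : Fin d → ℝ) : Prop where
  tendsto_pow : ∃ c : ℕ → ℝ,
    Tendsto (fun m => c m • (ρ (g ^ m)).val) atTop (𝓝 (vecMulVec x y'))
  tendsto_pow_inv : ∃ c : ℕ → ℝ,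
    Tendsto (fun m => c m • (ρ (g ^ m)⁻¹).val) atTop (𝓝 (vecMulVec x' y))
  left_ne : x ≠ 0
  left_ne' : y' ≠ 0
  right_ne : x' ≠ 0
  right_ne' : y ≠ 0
  incident : y ⬝ᵥ x = 0

theorem IsAttractingData.conj {ρ : G →* GL (Fin d) ℝ} {g : G} {x y' x' y : Fin d → ℝ}
    (h : IsAttractingData ρ g x y' x' y) (a : G) :
    IsAttractingData ρ (a * g * a⁻¹) ((ρ a).val *ᵥ x) (y' ᵥ* (ρ a⁻¹).val) ((ρ a).val *ᵥ x')
      (y ᵥ* (ρ a⁻¹).val) := by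
  have hinv : (ρ a⁻¹).val * (ρ a).val = 1 := by rw [← Units.val_mul, ← map_mul]; simp
  have h1 : ∀ v : Fin d → ℝ, v ≠ 0 → (ρ a).val *ᵥ v ≠ 0 := by
    intro v hv h0
    apply hv
    rw [← one_mulVec v, ← hinv, ← mulVec_mulVec, h0, mulVec_zero]
  have h2 : ∀ v : Fin d → ℝ, v ≠ 0 → v ᵥ* (ρ a⁻¹).val ≠ 0 := by
    intro v hv h0
    apply hv
    rw [← vecMul_one v, ← hinv, ← vecMul_vecMul, h0, zero_vecMul]
  refine ⟨?_, ?_, h1 _ h.left_ne, h2 _ h.left_ne', h1 _ h.right_ne, h2 _ h.right_ne', ?_⟩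
  · obtain ⟨c, hc⟩ := h.tendsto_pow
    refine ⟨c, ?_⟩
    have := (tendsto_const_nhds (x := (ρ a).val)).mul
      (hc.mul (tendsto_const_nhds (x := (ρ a⁻¹).val)))
    rw [vecMulVec_mul, mul_vecMulVec] at this
    refine this.congr fun m => ?_
    rw [conj_pow, map_mul, map_mul, Units.val_mul, Units.val_mul, smul_mul_assoc, mul_smul_comm,
      mul_assoc]
  · obtain ⟨c, hc⟩ := h.tendsto_pow_inv
    refine ⟨c, ?_⟩
    have := (tendsto_const_nhds (x := (ρ a).val)).mul
      (hc.mul (tendsto_const_nhds (x := (ρ a⁻¹).val)))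
    rw [vecMulVec_mul, mul_vecMulVec] at this
    refine this.congr fun m => ?_
    rw [conj_pow, show (a * g ^ m * a⁻¹)⁻¹ = a * (g ^ m)⁻¹ * a⁻¹ by group, map_mul, map_mul,
      Units.val_mul, Units.val_mul, smul_mul_assoc, mul_smul_comm, mul_assoc]
  · rw [← dotProduct_mulVec, mulVec_mulVec, hinv, one_mulVec, h.incident]

/-- Elements of the lattice approximate, projectively, the limits of `g ^ m` and `g ^ (-m)`. -/
theorem IsAttractingData.exists_mem_lattice {ρ : G →* GL (Fin d) ℝ} (hρ : IsRationalRep G ρ)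
    {Γ : Subgroup G} (hΓ : IsLatticeSubgroup Γ) {g : G} {x y' x' y : Fin d → ℝ}
    (h : IsAttractingData ρ g x y' x' y)
    {V : Set (Matrix (Fin d) (Fin d) ℝ × Matrix (Fin d) (Fin d) ℝ)}
    (hV : V ∈ 𝓝 (vecMulVec x y', vecMulVec x' y)) :
    ∃ γ ∈ Γ, ∃ s s' : ℝ, (s • (ρ γ).val, s' • (ρ γ⁻¹).val) ∈ V := by
  obtain ⟨c, hc⟩ := h.tendsto_pow
  obtain ⟨c', hc'⟩ := h.tendsto_pow_inv
  let F : (G × G) × (Matrix (Fin d) (Fin d) ℝ × Matrix (Fin d) (Fin d) ℝ) →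
      Matrix (Fin d) (Fin d) ℝ × Matrix (Fin d) (Fin d) ℝ := fun p =>
    ((ρ p.1.1⁻¹).val * p.2.1 * (ρ p.1.2).val, (ρ p.1.2⁻¹).val * p.2.2 * (ρ p.1.1).val)
  have hF : Continuous F := by
    have h1 := hρ.continuous
    have h2 : Continuous fun g : G => (ρ g⁻¹).val := h1.comp continuous_inv
    have e1 : Continuous fun p : (G × G) × (Matrix (Fin d) (Fin d) ℝ × Matrix (Fin d) (Fin d) ℝ) =>
      p.1.1 := by fun_prop
    have e2 : Continuous fun p : (G × G) × (Matrix (Fin d) (Fin d) ℝ × Matrix (Fin d) (Fin d) ℝ) =>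
      p.1.2 := by fun_prop
    exact (((h2.comp e1).mul (by fun_prop)).mul (h1.comp e2)).prodMk
      (((h2.comp e2).mul (by fun_prop)).mul (h1.comp e1))
  have hFV : F ⁻¹' V ∈ 𝓝 (((1 : G), (1 : G)), (vecMulVec x y', vecMulVec x' y)) :=
    hF.continuousAt.preimage_mem_nhds (by simpa [F] using hV)
  rw [nhds_prod_eq, nhds_prod_eq, mem_prod_iff] at hFV
  obtain ⟨t, ht, W, hW, htW⟩ := hFV
  obtain ⟨U₁, hU₁, U₂, hU₂, hUt⟩ := mem_prod_iff.1 ht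
  obtain ⟨N, hN⟩ := eventually_atTop.1 ((hc.prodMk_nhds hc').eventually_mem hW)
  obtain ⟨m, hm, u, hu, u', hu', hγ⟩ := hΓ.exists_pow_mem g N (inter_mem hU₁ hU₂)
  refine ⟨_, hγ, c m, c' m, ?_⟩
  have := htW (Set.mk_mem_prod (hUt (Set.mk_mem_prod hu.1 hu'.2)) (hN m hm))
  simpa [F, mul_assoc] using this

theorem vecMulVec_mul_mul_vecMulVec (x y' x' y : Fin d → ℝ) (M : Matrix (Fin d) (Fin d) ℝ) :
    vecMulVec x y' * M * vecMulVec x' y = (y' ⬝ᵥ M *ᵥ x') • vecMulVec x y := by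
  rw [vecMulVec_mul, vecMulVec_mul_vecMulVec, dotProduct_mulVec]
  ext i j
  simp [vecMulVec_apply]
  ring

/-- Conjugating by a lattice element close to a high power of `g` contracts, simultaneously for all
`M` in a compact set, the matrix `M` to the rank one matrix `x yᵀ`, provided that `M` never maps the
attracting point of `g⁻¹` into the repelling hyperplane of `g`. -/
theorem IsAttractingData.exists_conj_mem {ρ : G →* GL (Fin d) ℝ} (hρ : IsRationalRep G ρ)
    {Γ : Subgroup G} (hΓ : IsLatticeSubgroup Γ) {g : G} {x y' x' y : Fin d → ℝ}
    (h : IsAttractingData ρ g x y' x' y) {Q : Set (Matrix (Fin d) (Fin d) ℝ)} (hQ : IsCompact Q)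
    (hQ0 : ∀ M ∈ Q, y' ⬝ᵥ M *ᵥ x' ≠ 0) {N : Set (Matrix (Fin d) (Fin d) ℝ)}
    (hN : N ∈ 𝓝 (vecMulVec x y)) :
    ∃ γ ∈ Γ, ∀ M ∈ Q, ∃ s : ℝ, s • ((ρ γ).val * M * (ρ γ⁻¹).val) ∈ N := by
  have key : ∀ᶠ p in 𝓝 (vecMulVec x y', vecMulVec x' y), ∀ M ∈ Q,
      (y' ⬝ᵥ M *ᵥ x')⁻¹ • (p.1 * M * p.2) ∈ N := by
    refine hQ.eventually_forall_of_forall_eventually fun M hM => ?_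
    have hcont : ContinuousAt
        (fun z : (Matrix (Fin d) (Fin d) ℝ × Matrix (Fin d) (Fin d) ℝ) × Matrix (Fin d) (Fin d) ℝ =>
          (y' ⬝ᵥ z.2 *ᵥ x')⁻¹ • (z.1.1 * z.2 * z.1.2)) ((vecMulVec x y', vecMulVec x' y), M) := by
      refine ContinuousAt.smul (M := ℝ) (X := Matrix (Fin d) (Fin d) ℝ)
        (ContinuousAt.inv₀ ?_ (hQ0 M hM)) ?_
      · exact (continuous_const.dotProduct
          (continuous_snd.matrix_mulVec continuous_const)).continuousAt
      · exact Continuous.continuousAt (by fun_prop)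
    refine hcont.eventually_mem ?_
    simp only [vecMulVec_mul_mul_vecMulVec, smul_smul, inv_mul_cancel₀ (hQ0 M hM), one_smul]
    exact hN
  obtain ⟨γ, hγ, s, s', hs⟩ := h.exists_mem_lattice hρ hΓ key
  refine ⟨γ, hγ, fun M hM => ⟨(y' ⬝ᵥ M *ᵥ x')⁻¹ * (s * s'), ?_⟩⟩
  have := hs M hM
  simpa [smul_smul, mul_assoc, mul_comm, mul_left_comm] using this

end

/-! ### Powers of regular matrices -/

section

variable {d : ℕ}

/-- The powers of `A` converge projectively to (the class of) a matrix that is not scalar. -/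
def HasNonscalarLimit (A : Matrix (Fin d) (Fin d) ℝ) : Prop :=
  ∃ (c : ℕ → ℝ) (T : Matrix (Fin d) (Fin d) ℝ), (∀ s : ℝ, T ≠ s • 1) ∧
    Tendsto (fun m => c m • A ^ m) atTop (𝓝 T)

theorem tendsto_inv_choose_mul_choose {j k : ℕ} (hjk : j < k) :
    Tendsto (fun m : ℕ => (m.choose k : ℝ)⁻¹ * (m.choose j : ℝ)) atTop (𝓝 0) := by
  have hstep : ∀ i : ℕ, Tendsto (fun m : ℕ => (m.choose (i + 1) : ℝ)⁻¹ * (m.choose i : ℝ)) atTop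
      (𝓝 0) := by
    intro i
    have h1 : Tendsto (fun m : ℕ => ((i : ℝ) + 1) / ((m - i : ℕ) : ℝ)) atTop (𝓝 0) :=
      tendsto_const_nhds.div_atTop (tendsto_natCast_atTop_atTop.comp (tendsto_sub_atTop_nat i))
    refine h1.congr' ?_
    filter_upwards [eventually_ge_atTop (i + 1)] with m hm
    have h2 : (m.choose (i + 1) : ℝ) * (i + 1) = m.choose i * ((m - i : ℕ) : ℝ) := by
      exact_mod_cast Nat.choose_succ_right_eq m i
    have h3 : (m.choose (i + 1) : ℝ) ≠ 0 := by exact_mod_cast (Nat.choose_pos hm).ne'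
    have h4 : ((m - i : ℕ) : ℝ) ≠ 0 := by exact_mod_cast (by omega : m - i ≠ 0)
    rw [inv_mul_eq_div, div_eq_div_iff h4 h3, ← h2]
    ring
  induction k, hjk using Nat.le_induction with
  | base => exact hstep j
  | succ k hk ih =>
    have := (hstep k).mul ih
    rw [zero_mul] at this
    refine this.congr' ?_
    filter_upwards [eventually_ge_atTop k] with m hm
    have h3 : (m.choose k : ℝ) ≠ 0 := by exact_mod_cast (Nat.choose_pos hm).ne'
    field_simp

/-- If `B ^ k` is the last nonzero power of `B = A - 1`, then `A ^ m / (m choose k)` tends to it. -/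
theorem hasNonscalarLimit_of_isNilpotent [NeZero d] {A : Matrix (Fin d) (Fin d) ℝ}
    (hA : IsNilpotent (A - 1)) (hA1 : A ≠ 1) : HasNonscalarLimit A := by
  set B := A - 1 with hB
  have hAB : A = B + 1 := by simp [hB]
  have hB0 : B ≠ 0 := sub_ne_zero.2 hA1
  obtain ⟨k, hzero, hne⟩ : ∃ k, B ^ (k + 2) = 0 ∧ B ^ (k + 1) ≠ 0 := by
    classical
    have hex : ∃ k, B ^ k = 0 := hA
    have h2 : 2 ≤ Nat.find hex := by
      rw [Nat.le_find_iff]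
      intro m hm h0
      interval_cases m
      · rw [pow_zero] at h0
        exact one_ne_zero h0
      · exact hB0 (by simpa using h0)
    refine ⟨Nat.find hex - 2, ?_, Nat.find_min hex (by omega)⟩
    rw [Nat.sub_add_cancel h2]
    exact Nat.find_spec hex
  refine ⟨fun m => ((m.choose (k + 1) : ℕ) : ℝ)⁻¹, B ^ (k + 1), ?_, ?_⟩
  · intro s hs
    have h2 : B ^ (k + 1) * B ^ (k + 1) = 0 := by
      rw [← pow_add, show k + 1 + (k + 1) = (k + 2) + k by ring, pow_add, hzero, zero_mul]
    rw [hs] at h2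
    have h3 : s * s = 0 := by
      have := congrFun (congrFun h2 0) 0
      simpa using this
    apply hne
    rw [hs, mul_self_eq_zero.1 h3, zero_smul]
  · have hpow : ∀ m, A ^ m = ∑ j ∈ Finset.range (k + 2), (m.choose j : ℝ) • B ^ j := by
      intro m
      rw [hAB, (Commute.one_right B).add_pow]
      have hterm : ∀ j, B ^ j * 1 ^ (m - j) * ((m.choose j : ℕ) : Matrix (Fin d) (Fin d) ℝ) =
          (m.choose j : ℝ) • B ^ j := by
        intro j
        rw [one_pow, mul_one, ← nsmul_eq_mul', Nat.cast_smul_eq_nsmul]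
      simp only [hterm]
      -- both sums agree with the sum over a common larger range
      have hl : ∀ L ≥ m + 1, ∑ j ∈ Finset.range (m + 1), (m.choose j : ℝ) • B ^ j =
          ∑ j ∈ Finset.range L, (m.choose j : ℝ) • B ^ j := fun L hL =>
        Finset.sum_subset (Finset.range_subset_range.2 hL) fun j _ hj => by
          rw [Nat.choose_eq_zero_of_lt (by simpa using hj)]; simp
      have hr : ∀ L ≥ k + 2, ∑ j ∈ Finset.range (k + 2), (m.choose j : ℝ) • B ^ j =
          ∑ j ∈ Finset.range L, (m.choose j : ℝ) • B ^ j := fun L hL =>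
        Finset.sum_subset (Finset.range_subset_range.2 hL) fun j _ hj => by
          rw [pow_eq_zero_of_le (by simpa using hj) hzero, smul_zero]
      rw [hl (max (m + 1) (k + 2)) (le_max_left _ _), hr (max (m + 1) (k + 2)) (le_max_right _ _)]
    have hratio : ∀ j < k + 1, Tendsto
        (fun m : ℕ => (m.choose (k + 1) : ℝ)⁻¹ * (m.choose j : ℝ)) atTop (𝓝 0) := fun j hj =>
      tendsto_inv_choose_mul_choose hj
    have hlast : Tendsto (fun m : ℕ => (m.choose (k + 1) : ℝ)⁻¹ * (m.choose (k + 1) : ℝ)) atTop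
        (𝓝 1) := by
      refine tendsto_const_nhds.congr' ?_
      filter_upwards [eventually_ge_atTop (k + 1)] with m hm
      have : (m.choose (k + 1) : ℝ) ≠ 0 := by exact_mod_cast (Nat.choose_pos hm).ne'
      rw [inv_mul_cancel₀ this]
    have hlim : Tendsto (fun m : ℕ => ∑ j ∈ Finset.range (k + 1),
        ((m.choose (k + 1) : ℝ)⁻¹ * (m.choose j : ℝ)) • B ^ j +
        ((m.choose (k + 1) : ℝ)⁻¹ * (m.choose (k + 1) : ℝ)) • B ^ (k + 1)) atTop
        (𝓝 (∑ j ∈ Finset.range (k + 1), (0 : ℝ) • B ^ j + (1 : ℝ) • B ^ (k + 1))) :=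
      (tendsto_finsetSum _ fun j hj =>
        (hratio j (Finset.mem_range.1 hj)).smul_const _).add (hlast.smul_const _)
    simp only [zero_smul, Finset.sum_const_zero, zero_add, one_smul] at hlim
    refine hlim.congr fun m => ?_
    simp only [hpow, Finset.sum_range_succ _ (k + 1), smul_add, Finset.smul_sum, smul_smul]

/-- `A ^ m / l ^ m`, where `l` is the eigenvalue of largest absolute value, tends to the projection
to its eigenline. -/
theorem hasNonscalarLimit_of_mul_eq_mul_diagonal (hd : 2 ≤ d) {A P : Matrix (Fin d) (Fin d) ℝ}
    {l : Fin d → ℝ} (hl : Function.Injective fun i => |l i|) (hP : IsUnit P)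
    (h : A * P = P * diagonal l) : HasNonscalarLimit A := by
  have : NeZero d := ⟨by omega⟩
  obtain ⟨P, rfl⟩ := hP
  obtain ⟨i₀, hi₀⟩ := Finite.exists_max fun i => |l i|
  have hlt : ∀ i ≠ i₀, |l i| < |l i₀| := fun i hi => lt_of_le_of_ne (hi₀ i) fun h => hi (hl h)
  obtain ⟨i₁, hi₁⟩ : ∃ i₁ : Fin d, i₁ ≠ i₀ := by
    have : Nontrivial (Fin d) := Fin.nontrivial_iff_two_le.2 hd
    exact exists_ne i₀
  have h0 : l i₀ ≠ 0 := abs_pos.1 ((abs_nonneg _).trans_lt (hlt i₁ hi₁))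
  have hA : A = P.val * diagonal l * P⁻¹.val := by
    rw [← h, mul_assoc, Units.mul_inv, mul_one]
  refine ⟨fun m => (l i₀ ^ m)⁻¹, P.val * diagonal (Pi.single i₀ 1) * P⁻¹.val, ?_, ?_⟩
  · intro s hs
    have h1 : diagonal (Pi.single i₀ (1 : ℝ)) = s • (1 : Matrix (Fin d) (Fin d) ℝ) := by
      calc diagonal (Pi.single i₀ (1 : ℝ))
          = P⁻¹.val * (P.val * diagonal (Pi.single i₀ 1) * P⁻¹.val) * P.val := by
            simp [mul_assoc]
        _ = s • (1 : Matrix (Fin d) (Fin d) ℝ) := by rw [hs]; simp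
    have h2 := congrFun (congrFun h1 i₀) i₀
    have h3 := congrFun (congrFun h1 i₁) i₁
    simp [hi₁] at h2 h3
    rw [← h2] at h3
    exact one_ne_zero h3.symm
  · have hpow : ∀ m, A ^ m = P.val * diagonal (l ^ m) * P⁻¹.val := by
      intro m
      rw [hA, Units.conj_pow, diagonal_pow]
    have hdiag : Tendsto (fun m => (l i₀ ^ m)⁻¹ • diagonal (l ^ m)) atTop
        (𝓝 (diagonal (Pi.single i₀ (1 : ℝ)))) := by
      simp only [← diagonal_smul]
      refine ((continuous_id.matrix_diagonal (n := Fin d) (R := ℝ)).tendsto _).comp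
        (tendsto_pi_nhds.2 fun i => ?_)
      by_cases hi : i = i₀
      · subst hi
        simp [h0]
      · have hs : (Pi.single i₀ (1 : ℝ) : Fin d → ℝ) i = 0 := Pi.single_eq_of_ne hi 1
        have hr : |l i / l i₀| < 1 := by
          rw [abs_div, div_lt_one (abs_pos.2 h0)]
          exact hlt i hi
        change Tendsto _ _ (𝓝 ((Pi.single i₀ (1 : ℝ) : Fin d → ℝ) i))
        rw [hs]
        refine (tendsto_pow_atTop_nhds_zero_of_abs_lt_one hr).congr fun m => ?_
        rw [div_pow, div_eq_inv_mul]
        rfl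
    refine ((tendsto_const_nhds.mul hdiag).mul tendsto_const_nhds).congr fun m => ?_
    rw [hpow]
    simp [mul_assoc]

/-- Non-real eigenvalues come in conjugate pairs of equal absolute value, so a real matrix whose
eigenvalues have distinct absolute values is diagonalizable over the reals. -/
theorem HasDistinctAbsEigenvalues.exists_diagonal {A : Matrix (Fin d) (Fin d) ℝ}
    (hA : HasDistinctAbsEigenvalues A) :
    ∃ (P : Matrix (Fin d) (Fin d) ℝ) (l : Fin d → ℝ), (Function.Injective fun i => |l i|) ∧
      IsUnit P ∧ A * P = P * diagonal l := by
  have hA' : ((A.charpoly.aroots ℂ).map fun z => ‖z‖).Nodup := hA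
  have hmonic : A.charpoly.Monic := A.charpoly_monic
  have hmem : ∀ z : ℂ, z ∈ A.charpoly.aroots ℂ ↔ Polynomial.aeval z A.charpoly = 0 := fun z => by
    rw [Polynomial.mem_aroots]
    exact and_iff_right hmonic.ne_zero
  have hreal : ∀ z ∈ A.charpoly.aroots ℂ, (z.re : ℂ) = z := by
    intro z hz
    have hz' : (starRingEnd ℂ) z ∈ A.charpoly.aroots ℂ := by
      rw [hmem] at hz ⊢
      rw [Polynomial.aeval_conj, hz, map_zero]
    exact Complex.conj_eq_iff_re.1 (Multiset.inj_on_of_nodup_map hA' _ hz' _ hz (by simp))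
  have hnodup : (A.charpoly.aroots ℂ).Nodup := hA'.of_map
  have hcard : Fintype.card {z // z ∈ (A.charpoly.aroots ℂ).toFinset} = d := by
    rw [Fintype.card_coe, Multiset.toFinset_card_of_nodup hnodup,
      IsAlgClosed.card_aroots_eq_natDegree, charpoly_natDegree_eq_dim, Fintype.card_fin]
  let e := (Fintype.equivFinOfCardEq hcard).symm
  let l : Fin d → ℝ := fun i => (e i).1.re
  have hz : ∀ i, (e i).1 ∈ A.charpoly.aroots ℂ := fun i => Multiset.mem_toFinset.1 (e i).2
  have hlc : ∀ i, (l i : ℂ) = (e i).1 := fun i => hreal _ (hz i)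
  have hinj : Function.Injective fun i => |l i| := by
    intro i j hij
    have h1 : ‖(e i).1‖ = ‖(e j).1‖ := by
      rw [← hlc, ← hlc]
      simpa using hij
    exact e.injective (Subtype.ext (Multiset.inj_on_of_nodup_map hA' _ (hz i) _ (hz j) h1))
  have heig : ∀ i, ∃ v, Module.End.HasEigenvector (Matrix.toLin' A) (l i) v := by
    intro i
    have h1 : A.charpoly.IsRoot (l i) := by
      have := (hmem _).1 (hz i)
      rw [← hlc i, show ((l i : ℝ) : ℂ) = algebraMap ℝ ℂ (l i) from rfl,
        Polynomial.aeval_algebraMap_apply] at this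
      simpa [Polynomial.IsRoot] using this
    rw [← Matrix.charpoly_toLin', ← Module.End.hasEigenvalue_iff_isRoot_charpoly] at h1
    exact h1.exists_hasEigenvector
  choose v hv using heig
  have hli := Module.End.eigenvectors_linearIndependent' _ l
    (fun i j hij => hinj (by simp only [hij])) v hv
  refine ⟨(Matrix.of v)ᵀ, l, hinj, ?_, ?_⟩
  · rw [isUnit_transpose]
    exact Matrix.linearIndependent_rows_iff_isUnit.1 hli
  · ext i j
    have h1 := congrFun (hv j).apply_eq_smul i
    simp only [toLin'_apply, mulVec, dotProduct, Pi.smul_apply, smul_eq_mul] at h1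
    rw [mul_diagonal, mul_apply]
    simp only [transpose_apply, of_apply]
    rw [h1, mul_comm]

/-- The powers of a regular matrix and of its inverse converge projectively to a matrix that is
not scalar. -/
theorem IsRegularElt.hasNonscalarLimit (hd : 2 ≤ d) {g : GL (Fin d) ℝ} (hg : IsRegularElt g) :
    HasNonscalarLimit g.val ∧ HasNonscalarLimit g⁻¹.val := by
  have : NeZero d := ⟨by omega⟩
  rcases hg with ⟨h1, h2⟩ | hg
  · have hne : g.val ≠ 1 := by
      intro h
      rw [h, sub_self, zero_pow (by omega)] at h2
      exact h2 rfl
    refine ⟨hasNonscalarLimit_of_isNilpotent h1 hne, hasNonscalarLimit_of_isNilpotent ?_ ?_⟩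
    · have h3 : g⁻¹.val - 1 = -(g⁻¹.val * (g.val - 1)) := by
        rw [mul_sub, Units.inv_mul]; simp
      rw [h3, isNilpotent_neg_iff]
      refine Commute.isNilpotent_mul_left ?_ h1
      rw [Commute, SemiconjBy, mul_sub, sub_mul, Units.inv_mul, Units.mul_inv]
      simp
    · intro h
      apply hne
      rw [Units.val_eq_one] at h ⊢
      exact inv_eq_one.1 h
  · obtain ⟨P, l, hl, hP, h⟩ := hg.exists_diagonal
    refine ⟨hasNonscalarLimit_of_mul_eq_mul_diagonal hd hl hP h, ?_⟩
    have hP' := hP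
    obtain ⟨P, rfl⟩ := hP
    have hl0 : ∀ i, l i ≠ 0 := by
      have h1 : IsUnit (diagonal l) := by
        have : diagonal l = P⁻¹.val * (g.val * P.val) := by rw [h]; simp
        rw [this]
        exact P⁻¹.isUnit.mul (g.isUnit.mul P.isUnit)
      intro i
      have h2 := (Matrix.isUnit_iff_isUnit_det _).1 h1
      rw [det_diagonal] at h2
      exact Finset.prod_ne_zero_iff.1 h2.ne_zero i (Finset.mem_univ i)
    refine hasNonscalarLimit_of_mul_eq_mul_diagonal (l := fun i => (l i)⁻¹) hd ?_ hP' ?_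
    · intro i j hij
      exact hl (by simpa [abs_inv] using hij)
    · calc g⁻¹.val * P.val = g⁻¹.val * (P.val * diagonal l) * diagonal (fun i => (l i)⁻¹) := by
            rw [mul_assoc, mul_assoc, diagonal_mul_diagonal]
            simp [hl0]
        _ = P.val * diagonal (fun i => (l i)⁻¹) := by rw [← h, ← mul_assoc, Units.inv_mul, one_mul]

/-- If `A ^ k` were scalar, so would be every projective limit of the powers of `A`. -/
theorem HasNonscalarLimit.pow_ne_smul_one {A : Matrix (Fin d) (Fin d) ℝ}
    (hA : HasNonscalarLimit A) {k : ℕ} (hk : k ≠ 0) (s : ℝ) : A ^ k ≠ s • 1 := by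
  intro h
  obtain ⟨c, T, hT, hc⟩ := hA
  -- the scalar matrices form a closed set, which contains the multiples of `A ^ (k * m)`
  have hclosed : IsClosed ((Submodule.span ℝ {(1 : Matrix (Fin d) (Fin d) ℝ)} :
      Submodule ℝ (Matrix (Fin d) (Fin d) ℝ)) : Set (Matrix (Fin d) (Fin d) ℝ)) :=
    Submodule.closed_of_finiteDimensional _
  have hmem : T ∈ (Submodule.span ℝ {(1 : Matrix (Fin d) (Fin d) ℝ)} :
      Submodule ℝ (Matrix (Fin d) (Fin d) ℝ)) := by
    refine hclosed.mem_of_tendsto (hc.comp (tendsto_id.const_mul_atTop' (Nat.pos_of_ne_zero hk)))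
      (Eventually.of_forall fun m => ?_)
    simp only [Function.comp_apply, id, pow_mul, h, SetLike.mem_coe]
    rw [smul_pow, one_pow, smul_smul]
    exact Submodule.smul_mem _ _ (Submodule.mem_span_singleton_self _)
  obtain ⟨t, ht⟩ := Submodule.mem_span_singleton.1 hmem
  exact hT t ht.symm

end

/-! ### Generic position of the attracting data -/

section

variable {n d : ℕ} {G : Subgroup (GL (Fin n) ℝ)} {ρ : G →* GL (Fin d) ℝ}

theorem dotProduct_vecMulVec_mulVec (x y u v : Fin d → ℝ) :
    v ⬝ᵥ vecMulVec x y *ᵥ u = (v ⬝ᵥ x) * (y ⬝ᵥ u) := by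
  rw [vecMulVec_mulVec, dotProduct_smul]
  simp [mul_comm]

theorem vecMul_dotProduct_mulVec_mulVec (A M B : Matrix (Fin d) (Fin d) ℝ) (x y : Fin d → ℝ) :
    (y ᵥ* A) ⬝ᵥ M *ᵥ (B *ᵥ x) = y ⬝ᵥ (A * M * B) *ᵥ x := by
  rw [← dotProduct_mulVec, mulVec_mulVec, mulVec_mulVec]

/-- A point of a projective space on which `G` acts irreducibly can be moved off any hyperplane. -/
theorem exists_dotProduct_mulVec_ne_zero (hirr : (linearRep ρ).IsIrreducible) {x y : Fin d → ℝ}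
    (hx : x ≠ 0) (hy : y ≠ 0) : ∃ a : G, y ⬝ᵥ (ρ a).val *ᵥ x ≠ 0 := by
  by_contra! h
  let W : Subrepresentation (linearRep ρ) :=
    { toSubmodule := Submodule.span ℝ (Set.range fun a : G => (ρ a).val *ᵥ x)
      apply_mem_toSubmodule := by
        intro g v hv
        induction hv using Submodule.span_induction with
        | mem v hv =>
          obtain ⟨a, rfl⟩ := hv
          refine Submodule.subset_span ⟨g * a, ?_⟩
          simp [linearRep]
        | zero => simp
        | add u v _ _ hu hv => rw [map_add]; exact add_mem hu hv
        | smul c v _ hv => rw [map_smul]; exact Submodule.smul_mem _ _ hv }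
  have hxW : x ∈ W.toSubmodule := Submodule.subset_span ⟨1, by simp⟩
  have htop : W = ⊤ := by
    refine (hirr.eq_bot_or_eq_top W).resolve_left fun hbot => hx ?_
    rw [hbot] at hxW
    exact hxW
  have hW : ∀ v ∈ W.toSubmodule, y ⬝ᵥ v = 0 := by
    intro v hv
    induction hv using Submodule.span_induction with
    | mem v hv => obtain ⟨a, rfl⟩ := hv; exact h a
    | zero => simp
    | add u v _ _ hu hv => rw [dotProduct_add, hu, hv, add_zero]
    | smul c v _ hv => rw [dotProduct_smul, hv, smul_zero]
  exact hy (dotProduct_self_eq_zero.1 (hW y (by rw [htop]; trivial)))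

theorem dotProduct_mulVec_mem_regularFunctions (hρ : IsRationalRep G ρ) (x y : Fin d → ℝ)
    (M : Matrix (Fin d) (Fin d) ℝ) :
    (fun a : G => y ⬝ᵥ (M * (ρ a).val) *ᵥ x) ∈ regularFunctions G := by
  have : (fun a : G => y ⬝ᵥ (M * (ρ a).val) *ᵥ x) =
      ∑ i, ∑ j, ((y ᵥ* M) i * x j) • fun a : G => (ρ a).val i j := by
    funext a
    rw [← mulVec_mulVec, dotProduct_mulVec]
    simp only [dotProduct, mulVec, Finset.sum_apply, Pi.smul_apply, smul_eq_mul, Finset.mul_sum]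
    exact Finset.sum_congr rfl fun i _ => Finset.sum_congr rfl fun j _ => by ring
  rw [this]
  exact sum_mem fun i _ => sum_mem fun j _ => (regularFunctions G).smul_mem
    (rationalRep_entry_mem_regularFunctions hρ i j) _

theorem dotProduct_conj_mulVec_mem_regularFunctions (hρ : IsRationalRep G ρ) (x y : Fin d → ℝ)
    (M : Matrix (Fin d) (Fin d) ℝ) :
    (fun a : G => y ⬝ᵥ ((ρ a⁻¹).val * M * (ρ a).val) *ᵥ x) ∈ regularFunctions G := by
  have : (fun a : G => y ⬝ᵥ ((ρ a⁻¹).val * M * (ρ a).val) *ᵥ x) =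
      ∑ i, ∑ j, (y i • fun a : G => (ρ a⁻¹).val i j) *
        fun a : G => Pi.single j 1 ⬝ᵥ (M * (ρ a).val) *ᵥ x := by
    funext a
    rw [mul_assoc, ← mulVec_mulVec]
    simp only [dotProduct, mulVec, Finset.sum_apply, Pi.mul_apply, Pi.smul_apply, smul_eq_mul,
      Finset.mul_sum]
    refine Finset.sum_congr rfl fun i _ => Finset.sum_congr rfl fun j _ => ?_
    simp [Pi.single_apply, mul_assoc]
  rw [this]
  exact sum_mem fun i _ => sum_mem fun j _ => mul_mem ((regularFunctions G).smul_mem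
    (comp_inv_mem_regularFunctions (rationalRep_entry_mem_regularFunctions hρ i j)) _)
    (dotProduct_mulVec_mem_regularFunctions hρ _ _ _)

theorem exists_isAttractingData {p : ℙ ℝ (Fin d → ℝ) × ℙ ℝ (Fin d → ℝ)}
    (hp : p ∈ definedIncidentPairs ρ.range) :
    ∃ (g : G) (y' x' : Fin d → ℝ), IsAttractingData ρ g p.1.rep y' x' p.2.rep := by
  obtain ⟨hinc, _, ⟨g, rfl⟩, -, ⟨y', c, hc⟩, ⟨x', c', hc'⟩⟩ := hp
  refine ⟨g, y'.rep, x'.rep, ⟨c, hc.congr fun m => by simp⟩,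
    ⟨c', hc'.congr fun m => by rw [← inv_pow, map_pow, map_inv, Units.val_pow_eq_pow_val]⟩,
    p.1.rep_nonzero, y'.rep_nonzero, x'.rep_nonzero, p.2.rep_nonzero, ?_⟩
  have h1 : Projectivization.orthogonal p.2 p.1 := hinc
  rwa [← p.1.mk_rep, ← p.2.mk_rep, Projectivization.orthogonal_mk] at h1

/-- A linear map preserving every incidence relation `v ∈ H` is scalar. -/
theorem eq_smul_one_of_forall_incident [NeZero d] {M : Matrix (Fin d) (Fin d) ℝ}
    (h : ∀ x y : Fin d → ℝ, x ≠ 0 → y ≠ 0 → y ⬝ᵥ x = 0 → y ⬝ᵥ M *ᵥ x = 0) :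
    M = M 0 0 • 1 := by
  have hoff : ∀ i j, i ≠ j → M i j = 0 := by
    intro i j hij
    have := h (Pi.single j 1) (Pi.single i 1) (by simp) (by simp) (by simp [hij])
    simpa using this
  have hdiag : ∀ i j, i ≠ j → M i i = M j j := by
    intro i j hij
    have h1 : (Pi.single i 1 + Pi.single j 1 : Fin d → ℝ) ≠ 0 := fun h0 => by
      have := congrFun h0 i
      simp [hij] at this
    have h2 : (Pi.single i 1 - Pi.single j 1 : Fin d → ℝ) ≠ 0 := fun h0 => by
      have := congrFun h0 i
      simp [hij] at this
    have := h _ _ h1 h2 (by simp [hij, hij.symm])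
    simp only [mulVec_add, dotProduct_add, sub_dotProduct, mulVec_single_one, single_one_dotProduct,
      col_apply, hoff i j hij, hoff j i hij.symm] at this
    linarith
  ext i j
  by_cases hij : i = j
  · subst hij
    by_cases hi : i = 0
    · simp [hi]
    · simp [hdiag i 0 hi]
  · simp [hij, hoff i j hij]

/-- The incident pairs `(x, y)` with `y · M x = 0` form a subvariety, which is proper unless `M` is
scalar. -/
theorem exists_mem_definedIncidentPairs [NeZero d]
    (hpairs : ¬ ∃ X : Set (ℙ ℝ (Fin d → ℝ) × ℙ ℝ (Fin d → ℝ)),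
      IsIncidentSubvariety X ∧ X ≠ incidentPairs d ∧ definedIncidentPairs ρ.range ⊆ X)
    {M : Matrix (Fin d) (Fin d) ℝ} (hM : ∀ s : ℝ, M ≠ s • 1) :
    ∃ p ∈ definedIncidentPairs ρ.range, p.2.rep ⬝ᵥ M *ᵥ p.1.rep ≠ 0 := by
  by_contra! h
  let f : MvPolynomial (Fin d ⊕ Fin d) ℝ :=
    ∑ i, ∑ j, MvPolynomial.C (M i j) * (MvPolynomial.X (Sum.inr i) * MvPolynomial.X (Sum.inl j))
  have hf : ∀ x y : Fin d → ℝ, MvPolynomial.eval (Sum.elim x y) f = y ⬝ᵥ M *ᵥ x := by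
    intro x y
    simp only [f, map_sum, map_mul, MvPolynomial.eval_C, MvPolynomial.eval_X, Sum.elim_inl,
      Sum.elim_inr, dotProduct, mulVec, Finset.mul_sum]
    exact Finset.sum_congr rfl fun i _ => Finset.sum_congr rfl fun j _ => by ring
  have hbi : IsBihomogeneous f := by
    refine ⟨(1, 1), ?_⟩
    refine MvPolynomial.IsWeightedHomogeneous.sum _ _ _ fun i _ =>
      MvPolynomial.IsWeightedHomogeneous.sum _ _ _ fun j _ => ?_
    have h1 := (MvPolynomial.isWeightedHomogeneous_C (Sum.elim (fun _ : Fin d => ((1, 0) : ℕ × ℕ))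
      (fun _ : Fin d => ((0, 1) : ℕ × ℕ))) (M i j)).mul
      ((MvPolynomial.isWeightedHomogeneous_X ℝ _ (Sum.inr i)).mul
        (MvPolynomial.isWeightedHomogeneous_X ℝ _ (Sum.inl j)))
    simpa using h1
  refine hpairs ⟨_, ⟨{f}, by simpa using hbi, rfl⟩, fun heq => hM (M 0 0) ?_, fun p hp => ?_⟩
  · exact eq_smul_one_of_forall_incident fun x y hx hy hxy => by
      have hmem : (Projectivization.mk ℝ x hx, Projectivization.mk ℝ y hy) ∈ incidentPairs d :=
        (Projectivization.orthogonal_mk hy hx).2 hxy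
      rw [← heq] at hmem
      have h0 := hmem.2 f rfl
      rw [hf] at h0
      obtain ⟨a, ha⟩ := Projectivization.exists_smul_eq_mk_rep ℝ x hx
      obtain ⟨b, hb⟩ := Projectivization.exists_smul_eq_mk_rep ℝ y hy
      simp only [← ha, ← hb] at h0
      simpa [Units.smul_def, mulVec_smul] using h0
  · refine ⟨hp.1, fun q hq => ?_⟩
    rw [Set.mem_singleton_iff.1 hq, hf, h p hp]

/-- Every `G`-orbit of pairs (point, hyperplane) accumulates at every `G`-defined incident pair,
so no orbit is contained in the proper subvariety defined by a matrix that is not scalar. -/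
theorem exists_dotProduct_conj_mulVec_ne_zero [NeZero d]
    (hG : IsZariskiConnected (G : Set (GL (Fin n) ℝ))) (hρ : IsRationalRep G ρ)
    (hirr : (linearRep ρ).IsIrreducible)
    (hpairs : ¬ ∃ X : Set (ℙ ℝ (Fin d → ℝ) × ℙ ℝ (Fin d → ℝ)),
      IsIncidentSubvariety X ∧ X ≠ incidentPairs d ∧ definedIncidentPairs ρ.range ⊆ X)
    {M : Matrix (Fin d) (Fin d) ℝ} (hM : ∀ s : ℝ, M ≠ s • 1) {x y : Fin d → ℝ} (hx : x ≠ 0)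
    (hy : y ≠ 0) : ∃ a : G, y ⬝ᵥ ((ρ a⁻¹).val * M * (ρ a).val) *ᵥ x ≠ 0 := by
  by_contra! h
  obtain ⟨p, hp, hpM⟩ := exists_mem_definedIncidentPairs hpairs hM
  obtain ⟨g, y₁, x₁, hdata⟩ := exists_isAttractingData hp
  obtain ⟨b, hb⟩ := exists_dotProduct_mulVec_ne_zero hirr hdata.right_ne hy
  obtain ⟨a, ha⟩ := exists_forall_ne_zero_of_regularFunctions hG (Finset.univ : Finset (Fin 2))
    ![fun a => y₁ ⬝ᵥ (1 * (ρ a).val) *ᵥ x, fun a => y ⬝ᵥ (1 * (ρ a⁻¹).val) *ᵥ x₁]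
    (by
      intro i _
      fin_cases i
      · exact dotProduct_mulVec_mem_regularFunctions hρ _ _ _
      · exact comp_inv_mem_regularFunctions (dotProduct_mulVec_mem_regularFunctions hρ x₁ y 1))
    (by
      intro i _
      fin_cases i
      · simpa using exists_dotProduct_mulVec_ne_zero hirr hx hdata.left_ne'
      · exact ⟨b⁻¹, by simpa using hb⟩)
  have ha0 := ha 0 (Finset.mem_univ _)
  have ha1 := ha 1 (Finset.mem_univ _)
  simp only [cons_val_zero, cons_val_one, one_mul] at ha0 ha1
  obtain ⟨c, hc⟩ := hdata.tendsto_pow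
  obtain ⟨c', hc'⟩ := hdata.tendsto_pow_inv
  have hlim := ((tendsto_const_nhds (x := (ρ a⁻¹).val)).mul
    ((hc'.mul (tendsto_const_nhds (x := M))).mul hc)).mul (tendsto_const_nhds (x := (ρ a).val))
  have hcont : Continuous fun T : Matrix (Fin d) (Fin d) ℝ => y ⬝ᵥ T *ᵥ x := by fun_prop
  have hlim' := (hcont.tendsto _).comp hlim
  have hzero : Tendsto (fun _ : ℕ => (0 : ℝ)) atTop (𝓝 (y ⬝ᵥ ((ρ a⁻¹).val *
      (vecMulVec x₁ p.2.rep * M * vecMulVec p.1.rep y₁) * (ρ a).val) *ᵥ x)) := by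
    refine hlim'.congr fun m => ?_
    have := h (g ^ m * a)
    simp only [Function.comp_apply, smul_mul_assoc, mul_smul_comm, smul_mulVec, dotProduct_smul]
    rw [show (ρ a⁻¹).val * ((ρ (g ^ m)⁻¹).val * M * (ρ (g ^ m)).val) * (ρ a).val =
      (ρ (g ^ m * a)⁻¹).val * M * (ρ (g ^ m * a)).val by
        rw [_root_.mul_inv_rev, map_mul, map_mul, Units.val_mul, Units.val_mul]
        simp only [mul_assoc],
      this, smul_zero, smul_zero]
  have heq := tendsto_nhds_unique hzero tendsto_const_nhds
  rw [vecMulVec_mul_mul_vecMulVec, ← vecMul_dotProduct_mulVec_mulVec, smul_mulVec,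
    dotProduct_smul, dotProduct_vecMulVec_mulVec, ← dotProduct_mulVec] at heq
  exact mul_ne_zero hpM (mul_ne_zero ha1 ha0) heq

end

/-! ### Contracting all nontrivial powers simultaneously -/

section

variable {n d : ℕ} {G : Subgroup (GL (Fin n) ℝ)}

/-- Some `Γ`-conjugate of `γ` has all its powers `γ ^ k` with `K ≤ |k|` as close as desired,
projectively, to the rank one matrix `x yᵀ`. -/
def ContractsTo (ρ : G →* GL (Fin d) ℝ) (Γ : Subgroup G) (γ : G) (K : ℤ) (x y : Fin d → ℝ) : Prop :=
  ∀ N ∈ 𝓝 (vecMulVec x y), ∃ h ∈ Γ, ∀ k : ℤ, K ≤ |k| → ∃ s : ℝ, s • (ρ (h * γ ^ k * h⁻¹)).val ∈ N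

variable {ρ : G →* GL (Fin d) ℝ} {Γ : Subgroup G}

theorem exists_isCompact_mem_nhds {M : Matrix (Fin d) (Fin d) ℝ}
    {V : Set (Matrix (Fin d) (Fin d) ℝ)} (hV : V ∈ 𝓝 M) : ∃ N ∈ 𝓝 M, N ⊆ V ∧ IsCompact N := by
  have : LocallyCompactSpace (Matrix (Fin d) (Fin d) ℝ) :=
    inferInstanceAs (LocallyCompactSpace (Fin d → Fin d → ℝ))
  exact local_compact_nhds hV

theorem vecMulVec_ne_smul_one (hd : 2 ≤ d) {x y : Fin d → ℝ} (hx : x ≠ 0) (hy : y ≠ 0) (s : ℝ) :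
    vecMulVec x y ≠ s • 1 := by
  intro h
  have : Nontrivial (Fin d) := Fin.nontrivial_iff_two_le.2 hd
  obtain ⟨i, hi⟩ := Function.ne_iff.1 hx
  obtain ⟨j, hj⟩ := Function.ne_iff.1 hy
  have hij := congrFun (congrFun h i) j
  by_cases hij' : i = j
  · subst hij'
    obtain ⟨k, hk⟩ := exists_ne i
    have h1 := congrFun (congrFun h i) k
    have h2 := congrFun (congrFun h k) k
    simp only [vecMulVec_apply, Matrix.smul_apply, one_apply_eq, one_apply_ne hk.symm, smul_eq_mul,
      mul_zero, mul_one, mul_eq_zero] at h1 h2 hij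
    have hs : s ≠ 0 := by rw [← hij]; exact mul_ne_zero hi hj
    rcases h1 with h1 | h1
    · exact hi h1
    · exact hs (by rw [← h2, h1, mul_zero])
  · simp only [vecMulVec_apply, Matrix.smul_apply, one_apply_ne hij', smul_eq_mul, mul_zero,
      mul_eq_zero] at hij
    exact hij.elim hi hj

/-- The large powers of `γ` are controlled by the limits of `γ ^ m` and `γ ^ (-m)`. -/
theorem exists_contractsTo_of_limit (hρ : IsRationalRep G ρ) (hΓ : IsLatticeSubgroup Γ) {γ g : G}
    {x y' x' y : Fin d → ℝ} (h : IsAttractingData ρ g x y' x' y)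
    {c c' : ℕ → ℝ} {T T' : Matrix (Fin d) (Fin d) ℝ}
    (hc : Tendsto (fun m => c m • (ρ γ).val ^ m) atTop (𝓝 T))
    (hc' : Tendsto (fun m => c' m • (ρ γ)⁻¹.val ^ m) atTop (𝓝 T'))
    (hT : y' ⬝ᵥ T *ᵥ x' ≠ 0) (hT' : y' ⬝ᵥ T' *ᵥ x' ≠ 0) :
    ∃ K : ℤ, ContractsTo ρ Γ γ K x y := by
  have hcont : Continuous fun T : Matrix (Fin d) (Fin d) ℝ => y' ⬝ᵥ T *ᵥ x' := by fun_prop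
  have hopen : IsOpen {T : Matrix (Fin d) (Fin d) ℝ | y' ⬝ᵥ T *ᵥ x' ≠ 0} :=
    isOpen_ne_fun hcont continuous_const
  obtain ⟨K, hK⟩ := eventually_atTop.1 ((hc.eventually_mem (hopen.mem_nhds hT)).and
    (hc'.eventually_mem (hopen.mem_nhds hT')))
  refine ⟨K, fun N hN => ?_⟩
  have hQ := (hc.comp (tendsto_add_atTop_nat K)).isCompact_insert_range.union
    (hc'.comp (tendsto_add_atTop_nat K)).isCompact_insert_range
  obtain ⟨h₂, hh₂, hh⟩ := h.exists_conj_mem hρ hΓ hQ (by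
    rintro M ((rfl | ⟨m, rfl⟩) | (rfl | ⟨m, rfl⟩))
    · exact hT
    · exact (hK (m + K) (by omega)).1
    · exact hT'
    · exact (hK (m + K) (by omega)).2) hN
  refine ⟨h₂, hh₂, fun k hk => ?_⟩
  obtain ⟨j, hj | hj⟩ := k.eq_nat_or_neg
  · obtain ⟨s, hs⟩ := hh (c j • (ρ γ).val ^ j) (Or.inl (Or.inr ⟨j - K, by
      have : K ≤ j := by subst hj; simpa using hk
      simp [Nat.sub_add_cancel this]⟩))
    refine ⟨s * c j, ?_⟩
    rw [map_mul, map_mul, Units.val_mul, Units.val_mul, hj, zpow_natCast, map_pow,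
      Units.val_pow_eq_pow_val]
    simpa only [mul_smul_comm, smul_mul_assoc, smul_smul] using hs
  · obtain ⟨s, hs⟩ := hh (c' j • (ρ γ)⁻¹.val ^ j) (Or.inr (Or.inr ⟨j - K, by
      have : K ≤ j := by subst hj; simpa using hk
      simp [Nat.sub_add_cancel this]⟩))
    refine ⟨s * c' j, ?_⟩
    rw [map_mul, map_mul, Units.val_mul, Units.val_mul, hj, _root_.zpow_neg, zpow_natCast,
      ← inv_pow, map_pow, map_inv ρ γ, Units.val_pow_eq_pow_val]
    simpa only [mul_smul_comm, smul_mul_assoc, smul_smul] using hs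

/-- Contraction to `(x₀, y₀)` yields contraction to the pair of any `g` in general position to
`(x₀, y₀)`, by conjugating further with an approximation of a power of `g`. -/
theorem ContractsTo.trans (hρ : IsRationalRep G ρ) (hΓ : IsLatticeSubgroup Γ) {γ g : G} {K : ℤ}
    {x₀ y₀ x y' x' y : Fin d → ℝ} (h₀ : ContractsTo ρ Γ γ K x₀ y₀)
    (h : IsAttractingData ρ g x y' x' y) (h1 : y' ⬝ᵥ x₀ ≠ 0) (h2 : y₀ ⬝ᵥ x' ≠ 0) :
    ContractsTo ρ Γ γ K x y := by
  intro N hN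
  have hcont : Continuous fun T : Matrix (Fin d) (Fin d) ℝ => y' ⬝ᵥ T *ᵥ x' := by fun_prop
  have hopen : IsOpen {T : Matrix (Fin d) (Fin d) ℝ | y' ⬝ᵥ T *ᵥ x' ≠ 0} :=
    isOpen_ne_fun hcont continuous_const
  have hmem : vecMulVec x₀ y₀ ∈ {T : Matrix (Fin d) (Fin d) ℝ | y' ⬝ᵥ T *ᵥ x' ≠ 0} := by
    rw [Set.mem_ofPred_eq, dotProduct_vecMulVec_mulVec]
    exact mul_ne_zero h1 h2
  obtain ⟨Q, hQ, hQV, hQc⟩ := exists_isCompact_mem_nhds (hopen.mem_nhds hmem)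
  obtain ⟨a, ha, haQ⟩ := h₀ Q hQ
  obtain ⟨b, hb, hbN⟩ := h.exists_conj_mem hρ hΓ hQc (fun M hM => hQV hM) hN
  refine ⟨b * a, mul_mem hb ha, fun k hk => ?_⟩
  obtain ⟨s, hs⟩ := haQ k hk
  obtain ⟨t, ht⟩ := hbN _ hs
  refine ⟨t * s, ?_⟩
  rw [show b * a * γ ^ k * (b * a)⁻¹ = b * (a * γ ^ k * a⁻¹) * b⁻¹ by group, map_mul, map_mul ρ b,
    Units.val_mul, Units.val_mul]
  simpa only [mul_smul_comm, smul_mul_assoc, smul_smul] using ht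

theorem zpow_conj_ne_smul_one {γ : G} (h : HasNonscalarLimit (ρ γ).val)
    (h' : HasNonscalarLimit (ρ γ)⁻¹.val) (b : G) {k : ℤ} (hk : k ≠ 0) (s : ℝ) :
    (ρ (b * γ ^ k * b⁻¹)).val ≠ s • 1 := by
  intro hs
  have h1 : (ρ (γ ^ k)).val = s • 1 := by
    calc (ρ (γ ^ k)).val = (ρ b⁻¹).val * (ρ (b * γ ^ k * b⁻¹)).val * (ρ b).val := by
          rw [← Units.val_mul, ← Units.val_mul, ← map_mul, ← map_mul]
          congr 2
          group
      _ = s • 1 := by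
          rw [hs, mul_smul_comm, smul_mul_assoc, mul_one, ← Units.val_mul, ← map_mul]
          simp
  obtain ⟨j, rfl | rfl⟩ := k.eq_nat_or_neg
  · rw [zpow_natCast, map_pow, Units.val_pow_eq_pow_val] at h1
    exact h.pow_ne_smul_one (by simpa using hk) s h1
  · rw [_root_.zpow_neg, zpow_natCast, ← inv_pow, map_pow, map_inv ρ γ,
      Units.val_pow_eq_pow_val] at h1
    exact h'.pow_ne_smul_one (by simpa using hk) s h1

theorem prod_mem_submodule_pow {A ι : Type*} [CommRing A] [Algebra ℝ A] (W : Submodule ℝ A)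
    (s : Finset ι) (f : ι → A) (hf : ∀ i ∈ s, f i ∈ W) : ∏ i ∈ s, f i ∈ W ^ s.card := by
  classical
  induction s using Finset.induction_on with
  | empty => exact Submodule.one_le.1 le_rfl
  | insert i s hi ih =>
    rw [Finset.prod_insert hi, Finset.card_insert_of_notMem hi, pow_succ']
    exact Submodule.mul_mem_mul (hf i (by simp)) (ih fun j hj => hf j (by simp [hj]))

/-- The finitely many small powers `γ ^ k` are brought under control by varying the conjugating
element over a finite set `S` fixed in advance: `S` is chosen to detect the nonvanishing of any
product of boundedly many functions `a ↦ y' · ρ(a)⁻¹ M ρ(a) x'`. -/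
theorem ContractsTo.exists_one (hd : 2 ≤ d)
    (hG : IsZariskiConnected (G : Set (GL (Fin n) ℝ))) (hρ : IsRationalRep G ρ)
    (hirr : (linearRep ρ).IsIrreducible)
    (hpairs : ¬ ∃ X : Set (ℙ ℝ (Fin d → ℝ) × ℙ ℝ (Fin d → ℝ)),
      IsIncidentSubvariety X ∧ X ≠ incidentPairs d ∧ definedIncidentPairs ρ.range ⊆ X)
    (hΓ : IsLatticeSubgroup Γ) {γ g : G} {K : ℤ} {x₀ y₀ x y' x' y : Fin d → ℝ}
    (hlim : HasNonscalarLimit (ρ γ).val) (hlim' : HasNonscalarLimit (ρ γ)⁻¹.val)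
    (hx₀ : x₀ ≠ 0) (hy₀ : y₀ ≠ 0)
    (h₀ : ContractsTo ρ Γ γ K x₀ y₀) (h : IsAttractingData ρ g x y' x' y) :
    ∃ a : G, ContractsTo ρ Γ γ 1 ((ρ a).val *ᵥ x) (y ᵥ* (ρ a⁻¹).val) := by
  classical
  have : NeZero d := ⟨by omega⟩
  let Φ : Matrix (Fin d) (Fin d) ℝ →ₗ[ℝ] (G → ℝ) :=
    { toFun := fun M a => y' ⬝ᵥ ((ρ a⁻¹).val * M * (ρ a).val) *ᵥ x'
      map_add' := fun M N => by
        funext a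
        simp [mul_add, add_mul, add_mulVec, dotProduct_add]
      map_smul' := fun c M => by
        funext a
        simp [smul_mulVec, dotProduct_smul] }
  have hΦ : ∀ M a, Φ M a = y' ⬝ᵥ ((ρ a⁻¹).val * M * (ρ a).val) *ᵥ x' := fun _ _ => rfl
  let I : Finset ℤ := (Finset.Ioo (-K) K).erase 0
  obtain ⟨S, hS⟩ := exists_finset_determining
    (LinearMap.range Φ * LinearMap.range Φ ^ I.card)
    ((Module.Finite.iff_fg.1 inferInstance : (LinearMap.range Φ).FG).mul
      ((Module.Finite.iff_fg.1 inferInstance : (LinearMap.range Φ).FG).pow _))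
  have hΦcont : ∀ a, Continuous fun M => Φ M a := by
    intro a
    simp only [hΦ]
    fun_prop
  let M₀ := vecMulVec x₀ y₀
  have hV : {M | ∀ a ∈ S, Φ M₀ a ≠ 0 → Φ M a ≠ 0} ∈ 𝓝 M₀ := by
    have : ∀ᶠ M in 𝓝 M₀, ∀ a ∈ S, Φ M₀ a ≠ 0 → Φ M a ≠ 0 := by
      rw [Finset.eventually_all]
      intro a _
      by_cases ha : Φ M₀ a = 0
      · simp [ha]
      · filter_upwards [(isOpen_ne_fun (hΦcont a) continuous_const).mem_nhds ha] with M hM _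
        exact hM
    exact this
  obtain ⟨Q₀, hQ₀, hQ₀V, hQ₀c⟩ := exists_isCompact_mem_nhds hV
  obtain ⟨b, hb, hbQ⟩ := h₀ Q₀ hQ₀
  let M : ℤ → Matrix (Fin d) (Fin d) ℝ := fun k => (ρ (b * γ ^ k * b⁻¹)).val
  obtain ⟨a, haS, ha₀, haM⟩ : ∃ a ∈ S, Φ M₀ a ≠ 0 ∧ ∀ k ∈ I, Φ (M k) a ≠ 0 := by
    have hne : ∀ A : Matrix (Fin d) (Fin d) ℝ, (∀ s : ℝ, A ≠ s • 1) → ∃ a, Φ A a ≠ 0 := fun A hA =>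
      exists_dotProduct_conj_mulVec_ne_zero hG hρ hirr hpairs hA h.right_ne h.left_ne'
    have hreg : ∀ A, Φ A ∈ regularFunctions G := fun A =>
      dotProduct_conj_mulVec_mem_regularFunctions hρ _ _ _
    obtain ⟨e, he⟩ := exists_forall_ne_zero_of_regularFunctions hG (insert (Φ M₀) (I.image (Φ ∘ M)))
      id (by
        intro f hf
        rcases Finset.mem_insert.1 hf with rfl | hf
        · exact hreg _
        · obtain ⟨k, -, rfl⟩ := Finset.mem_image.1 hf
          exact hreg _)
      (by
        intro f hf
        rcases Finset.mem_insert.1 hf with rfl | hf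
        · exact hne _ (vecMulVec_ne_smul_one hd hx₀ hy₀)
        · obtain ⟨k, hk, rfl⟩ := Finset.mem_image.1 hf
          exact hne _ (zpow_conj_ne_smul_one hlim hlim' b (Finset.ne_of_mem_erase hk)))
    by_contra! hcon
    have hprod := hS (Φ M₀ * ∏ k ∈ I, Φ (M k)) (Submodule.mul_mem_mul ⟨M₀, rfl⟩
      (prod_mem_submodule_pow _ _ _ fun k _ => ⟨M k, rfl⟩)) (by
        intro a ha
        rw [Pi.mul_apply, Finset.prod_apply]
        by_cases h0 : Φ M₀ a = 0
        · rw [h0, zero_mul]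
        · obtain ⟨k, hk, hk0⟩ := hcon a ha h0
          rw [Finset.prod_eq_zero hk hk0, mul_zero])
    have he' := congrFun hprod e
    rw [Pi.mul_apply, Finset.prod_apply] at he'
    refine mul_ne_zero (he _ (Finset.mem_insert_self _ _))
      (Finset.prod_ne_zero_iff.2 fun k hk => ?_) he'
    exact he _ (Finset.mem_insert_of_mem (Finset.mem_image_of_mem _ hk))
  refine ⟨a, fun N hN => ?_⟩
  have hQc : IsCompact (Q₀ ∪ M '' I) := hQ₀c.union (I.finite_toSet.image M).isCompact
  obtain ⟨e, he, heN⟩ := (h.conj a).exists_conj_mem hρ hΓ hQc (by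
    intro A hA
    rw [vecMul_dotProduct_mulVec_mulVec, ← hΦ]
    rcases hA with hA | ⟨k, hk, rfl⟩
    · exact hQ₀V hA a haS ha₀
    · exact haM k hk) hN
  refine ⟨e * b, mul_mem he hb, fun k hk => ?_⟩
  obtain ⟨r, hr⟩ : ∃ r : ℝ, r • M k ∈ Q₀ ∪ M '' I := by
    by_cases hkK : K ≤ |k|
    · obtain ⟨r, hr⟩ := hbQ k hkK
      exact ⟨r, Or.inl hr⟩
    · refine ⟨1, Or.inr ⟨k, ?_, (one_smul _ _).symm⟩⟩
      have hk0 : k ≠ 0 := by rintro rfl; simp at hk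
      have := abs_lt.1 (not_le.1 hkK)
      simp [I, hk0, this.1, this.2]
  obtain ⟨t, ht⟩ := heN _ hr
  refine ⟨t * r, ?_⟩
  rw [show e * b * γ ^ k * (e * b)⁻¹ = e * (b * γ ^ k * b⁻¹) * e⁻¹ by group, map_mul, map_mul ρ e,
    Units.val_mul, Units.val_mul]
  simpa only [M, mul_smul_comm, smul_mul_assoc, smul_smul] using ht

/-- Every nontrivial conjugacy class of `Γ` contains elements all of whose nontrivial powers are
close to `x yᵀ`, for each incident pair `(x, y)` defined by `G`. -/
theorem IsAttractingData.contractsTo (hd : 2 ≤ d)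
    (hG : IsZariskiConnected (G : Set (GL (Fin n) ℝ))) (hρ : IsRationalRep G ρ)
    (hirr : (linearRep ρ).IsIrreducible)
    (hpairs : ¬ ∃ X : Set (ℙ ℝ (Fin d → ℝ) × ℙ ℝ (Fin d → ℝ)),
      IsIncidentSubvariety X ∧ X ≠ incidentPairs d ∧ definedIncidentPairs ρ.range ⊆ X)
    (hΓ : IsLatticeSubgroup Γ) {γ g : G} {x y' x' y : Fin d → ℝ}
    (hlim : HasNonscalarLimit (ρ γ).val) (hlim' : HasNonscalarLimit (ρ γ)⁻¹.val)
    (h : IsAttractingData ρ g x y' x' y) : ContractsTo ρ Γ γ 1 x y := by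
  have : NeZero d := ⟨by omega⟩
  obtain ⟨a₁, K, hK⟩ : ∃ (a : G) (K : ℤ),
      ContractsTo ρ Γ γ K ((ρ a).val *ᵥ x) (y ᵥ* (ρ a⁻¹).val) := by
    obtain ⟨c, T, hT, hc⟩ := hlim
    obtain ⟨c', T', hT', hc'⟩ := hlim'
    obtain ⟨a, ha⟩ := exists_forall_ne_zero_of_regularFunctions hG (Finset.univ : Finset (Fin 2))
      (fun i a => y' ⬝ᵥ ((ρ a⁻¹).val * ![T, T'] i * (ρ a).val) *ᵥ x')
      (fun i _ => dotProduct_conj_mulVec_mem_regularFunctions hρ _ _ _)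
      (fun i _ => exists_dotProduct_conj_mulVec_ne_zero hG hρ hirr hpairs
        (by fin_cases i; exacts [hT, hT']) h.right_ne h.left_ne')
    refine ⟨a, exists_contractsTo_of_limit hρ hΓ (h.conj a) hc hc' ?_ ?_⟩
    · rw [vecMul_dotProduct_mulVec_mulVec]
      exact ha 0 (Finset.mem_univ _)
    · rw [vecMul_dotProduct_mulVec_mulVec]
      exact ha 1 (Finset.mem_univ _)
  obtain ⟨a₂, h₂⟩ := hK.exists_one hd hG hρ hirr hpairs hΓ hlim hlim' (h.conj a₁).left_ne
    (h.conj a₁).right_ne' h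
  have h₂data := h.conj a₂
  -- pass from the pair obtained to `(x, y)` through a third pair in general position to both
  obtain ⟨a, ha⟩ := exists_forall_ne_zero_of_regularFunctions hG (Finset.univ : Finset (Fin 4))
    ![fun a => y' ⬝ᵥ (1 * (ρ a⁻¹).val) *ᵥ ((ρ a₂).val *ᵥ x),
      fun a => (y ᵥ* (ρ a₂⁻¹).val) ⬝ᵥ (1 * (ρ a).val) *ᵥ x',
      fun a => y' ⬝ᵥ (1 * (ρ a).val) *ᵥ x,
      fun a => y ⬝ᵥ (1 * (ρ a⁻¹).val) *ᵥ x']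
    (by
      intro i _
      fin_cases i
      · exact comp_inv_mem_regularFunctions (dotProduct_mulVec_mem_regularFunctions hρ _ y' 1)
      · exact dotProduct_mulVec_mem_regularFunctions hρ _ _ _
      · exact dotProduct_mulVec_mem_regularFunctions hρ _ _ _
      · exact comp_inv_mem_regularFunctions (dotProduct_mulVec_mem_regularFunctions hρ _ y 1))
    (by
      intro i _
      fin_cases i
      · obtain ⟨b, hb⟩ := exists_dotProduct_mulVec_ne_zero hirr h₂data.left_ne h.left_ne'
        refine ⟨b⁻¹, ?_⟩
        change y' ⬝ᵥ (1 * (ρ b⁻¹⁻¹).val) *ᵥ ((ρ a₂).val *ᵥ x) ≠ 0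
        rwa [one_mul, _root_.inv_inv]
      · obtain ⟨b, hb⟩ := exists_dotProduct_mulVec_ne_zero hirr h.right_ne h₂data.right_ne'
        refine ⟨b, ?_⟩
        change (y ᵥ* (ρ a₂⁻¹).val) ⬝ᵥ (1 * (ρ b).val) *ᵥ x' ≠ 0
        rwa [one_mul]
      · obtain ⟨b, hb⟩ := exists_dotProduct_mulVec_ne_zero hirr h.left_ne h.left_ne'
        refine ⟨b, ?_⟩
        change y' ⬝ᵥ (1 * (ρ b).val) *ᵥ x ≠ 0
        rwa [one_mul]
      · obtain ⟨b, hb⟩ := exists_dotProduct_mulVec_ne_zero hirr h.right_ne h.right_ne'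
        refine ⟨b⁻¹, ?_⟩
        change y ⬝ᵥ (1 * (ρ b⁻¹⁻¹).val) *ᵥ x' ≠ 0
        rwa [one_mul, _root_.inv_inv])
  simp only [one_mul] at ha
  have h₃ := h₂.trans hρ hΓ (h.conj a) (by
    rw [← dotProduct_mulVec]; exact ha 0 (Finset.mem_univ _)) (ha 1 (Finset.mem_univ _))
  exact h₃.trans hρ hΓ h (ha 2 (Finset.mem_univ _)) (by
    rw [← dotProduct_mulVec]; exact ha 3 (Finset.mem_univ _))

end

/-! ### Ping-pong with infinitely many players -/

section

variable {d : ℕ}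

theorem abs_dotProduct_le (y u : Fin d → ℝ) : |y ⬝ᵥ u| ≤ d * ‖y‖ * ‖u‖ := by
  calc |y ⬝ᵥ u| ≤ ∑ i, |y i * u i| := Finset.abs_sum_le_sum_abs _ _
    _ ≤ ∑ _i : Fin d, ‖y‖ * ‖u‖ := Finset.sum_le_sum fun i _ => by
        rw [abs_mul]
        exact mul_le_mul (norm_le_pi_norm y i) (norm_le_pi_norm u i) (abs_nonneg _) (norm_nonneg _)
    _ = d * ‖y‖ * ‖u‖ := by simp [mul_assoc]

theorem norm_mulVec_le {E : Matrix (Fin d) (Fin d) ℝ} {δ : ℝ} (hδ : 0 ≤ δ)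
    (hE : ∀ i j, |E i j| ≤ δ) (u : Fin d → ℝ) : ‖E *ᵥ u‖ ≤ d * δ * ‖u‖ := by
  refine (pi_norm_le_iff_of_nonneg (by positivity)).2 fun i => ?_
  refine (abs_dotProduct_le (E i) u).trans ?_
  gcongr
  exact (pi_norm_le_iff_of_nonneg hδ).2 fun j => hE i j

/-- A convergent sequence of reals, nonzero off one index and in the limit, is bounded away from
zero off that index. -/
theorem exists_pos_le_abs_of_tendsto {u : ℕ → ℝ} {l : ℝ} (hu : Tendsto u atTop (𝓝 l)) (hl : l ≠ 0)
    {i : ℕ} (h : ∀ j ≠ i, u j ≠ 0) : ∃ η > 0, ∀ j ≠ i, η ≤ |u j| := by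
  have h1 : Tendsto (fun j => |u j|⁻¹) atTop (𝓝 |l|⁻¹) := hu.abs.inv₀ (abs_ne_zero.2 hl)
  obtain ⟨b, hb⟩ := h1.bddAbove_range
  refine ⟨(max b 1)⁻¹, by positivity, fun j hj => ?_⟩
  rw [inv_le_comm₀ (by positivity) (abs_pos.2 (h j hj))]
  exact (hb ⟨j, rfl⟩).trans (le_max_left _ _)

/-- The ping-pong lemma for countably many elements, all of whose nontrivial powers are
projectively close to rank one matrices `xᵢ yᵢᵀ` with `yᵢ · xᵢ = 0` and `yᵢ · xⱼ ≠ 0` for `i ≠ j`.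
Each player has a single cone, a neighbourhood of the line of `xᵢ`, which all nontrivial powers map
the other cones into. The convergence of the pairs `(xᵢ, yᵢ)` keeps `yᵢ · xⱼ` away from zero when
one of the two indices is fixed, so the closeness required of the `i`-th element depends on `i`
alone. -/
theorem exists_injective_lift_of_contracting {Λ : Type*} [Group Λ] (φ : Λ →* GL (Fin d) ℝ)
    {x y : ℕ → Fin d → ℝ} {x₀ y₀ : Fin d → ℝ} (hx : Tendsto x atTop (𝓝 x₀))
    (hy : Tendsto y atTop (𝓝 y₀)) (hx₀ : x₀ ≠ 0) (hx0 : ∀ i, x i ≠ 0)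
    (hinc : ∀ i, y i ⬝ᵥ x i = 0) (hne : ∀ i j, i ≠ j → y i ⬝ᵥ x j ≠ 0)
    (hlim : ∀ i, y i ⬝ᵥ x₀ ≠ 0) (hlim' : ∀ i, y₀ ⬝ᵥ x i ≠ 0) (e : ℕ → Λ)
    (h : ∀ i, ∀ N ∈ 𝓝 (vecMulVec (x i) (y i)), ∃ c : Λ, ∀ k : ℤ, k ≠ 0 →
      ∃ s : ℝ, s • (φ (c * e i ^ k * c⁻¹)).val ∈ N) :
    ∃ c : ℕ → Λ, Function.Injective (FreeGroup.lift fun i => c i * e i * (c i)⁻¹) := by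
  obtain ⟨b, hb, hxb⟩ : ∃ b > 0, ∀ i, b ≤ ‖x i‖ := by
    have h1 : Tendsto (fun j => ‖x j‖⁻¹) atTop (𝓝 ‖x₀‖⁻¹) := hx.norm.inv₀ (norm_ne_zero_iff.2 hx₀)
    obtain ⟨b, hb⟩ := h1.bddAbove_range
    refine ⟨(max b 1)⁻¹, by positivity, fun j => ?_⟩
    rw [inv_le_comm₀ (by positivity) (norm_pos_iff.2 (hx0 j))]
    exact (hb ⟨j, rfl⟩).trans (le_max_left _ _)
  obtain ⟨B, hB, hxB, hyB⟩ : ∃ B > 0, (∀ i, ‖x i‖ ≤ B) ∧ ∀ i, ‖y i‖ ≤ B := by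
    obtain ⟨B₁, hB₁⟩ := hx.norm.bddAbove_range
    obtain ⟨B₂, hB₂⟩ := hy.norm.bddAbove_range
    exact ⟨max 1 (max B₁ B₂), by positivity,
      fun i => (hB₁ ⟨i, rfl⟩).trans ((le_max_left _ _).trans (le_max_right _ _)),
      fun i => (hB₂ ⟨i, rfl⟩).trans ((le_max_right _ _).trans (le_max_right _ _))⟩
  obtain ⟨C, hC, hyC⟩ : ∃ C > 0, ∀ i u, |y i ⬝ᵥ u| ≤ C * ‖u‖ := by
    refine ⟨d * B + 1, by positivity, fun i u => (abs_dotProduct_le _ _).trans ?_⟩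
    have := hyB i
    gcongr
    have : d * ‖y i‖ ≤ d * B := by gcongr
    linarith
  have hη : ∀ i, ∃ η > 0, ∀ j ≠ i, η ≤ |y i ⬝ᵥ x j| ∧ η ≤ |y j ⬝ᵥ x i| := by
    intro i
    obtain ⟨η₁, h₁, h₁'⟩ := exists_pos_le_abs_of_tendsto (i := i)
      (((continuous_const.dotProduct continuous_id).tendsto x₀).comp hx) (hlim i)
      fun j hj => hne i j hj.symm
    obtain ⟨η₂, h₂, h₂'⟩ := exists_pos_le_abs_of_tendsto (i := i)
      (((continuous_id.dotProduct continuous_const).tendsto y₀).comp hy) (hlim' i)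
      fun j hj => hne j i hj
    exact ⟨min η₁ η₂, lt_min h₁ h₂, fun j hj =>
      ⟨(min_le_left _ _).trans (h₁' j hj), (min_le_right _ _).trans (h₂' j hj)⟩⟩
  choose η hη0 hη1 using hη
  have hbB : b ≤ B := (hxb 0).trans (hxB 0)
  -- `r i` is the radius of the `i`-th cone, and `δ i` below the precision required of the `i`-th
  -- element; the second bound for `r i` makes the cones disjoint and keeps `yᵢ` off the others
  let r : ℕ → ℝ := fun i => min (b / 2) (b * η i / (16 * B * C))
  have hr0 : ∀ i, 0 < r i := fun i => by
    have := hη0 i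
    positivity
  have hrb : ∀ i, r i ≤ b / 2 := fun i => min_le_left _ _
  have hrC : ∀ i, C * r i ≤ b * η i / (16 * B) := fun i => by
    calc C * r i ≤ C * (b * η i / (16 * B * C)) := by gcongr; exact min_le_right _ _
      _ = b * η i / (16 * B) := by field_simp
  have hrη : ∀ i, C * r i ≤ η i / 2 := fun i => by
    refine (hrC i).trans ?_
    have := hη0 i
    rw [div_le_div_iff₀ (by positivity) (by positivity)]
    nlinarith [mul_le_mul_of_nonneg_right hbB this.le, mul_pos hB this]
  have hlow : ∀ i j, i ≠ j → ∀ w, ‖w - x j‖ < r j → η i / 2 ≤ |y i ⬝ᵥ w| := by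
    intro i j hij w hw
    have h1 : y i ⬝ᵥ w = y i ⬝ᵥ x j + y i ⬝ᵥ (w - x j) := by
      rw [← dotProduct_add, add_sub_cancel]
    have h2 : |y i ⬝ᵥ (w - x j)| ≤ η j / 2 :=
      (hyC _ _).trans ((mul_le_mul_of_nonneg_left hw.le hC.le).trans (hrη j))
    have h3 := (hη1 i j hij.symm).1
    have h4 := (hη1 j i hij).2
    have h5 := abs_sub_abs_le_abs_sub (y i ⬝ᵥ x j) (-(y i ⬝ᵥ (w - x j)))
    rw [abs_neg, sub_neg_eq_add, ← h1] at h5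
    linarith
  have hnorm : ∀ j w, ‖w - x j‖ < r j → b / 2 ≤ ‖w‖ ∧ ‖w‖ ≤ 2 * B := by
    intro j w hw
    have h1 := norm_sub_norm_le (x j) w
    have h2 := norm_sub_norm_le w (x j)
    rw [norm_sub_rev] at h1
    have := hrb j
    have := hxb j
    have := hxB j
    constructor <;> linarith
  let δ : ℕ → ℝ := fun i => r i * η i / (4 * B * (d + 1))
  have hδ0 : ∀ i, 0 < δ i := fun i => by
    have := hr0 i
    have := hη0 i
    positivity
  have hN : ∀ i, {M : Matrix (Fin d) (Fin d) ℝ |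
      ∀ p q, |(M - vecMulVec (x i) (y i)) p q| < δ i} ∈ 𝓝 (vecMulVec (x i) (y i)) := by
    intro i
    have hopen : IsOpen {M : Matrix (Fin d) (Fin d) ℝ |
        ∀ p q, |(M - vecMulVec (x i) (y i)) p q| < δ i} := by
      simp only [Set.ofPred_forall]
      refine isOpen_iInter_of_finite fun p => isOpen_iInter_of_finite fun q => ?_
      exact isOpen_lt (((continuous_id.sub continuous_const).matrix_elem p q).abs) continuous_const
    exact hopen.mem_nhds (fun p q => by simpa using hδ0 i)
  choose c hc using fun i => h i _ (hN i)
  refine ⟨c, ?_⟩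
  let a : ℕ → Λ := fun i => c i * e i * (c i)⁻¹
  have ha : ∀ i (k : ℤ), k ≠ 0 → ∃ s : ℝ, ∀ p q,
      |(s • (φ (a i ^ k)).val - vecMulVec (x i) (y i)) p q| < δ i := by
    intro i k hk
    obtain ⟨s, hs⟩ := hc i k hk
    refine ⟨s, ?_⟩
    simp only [a, conj_zpow]
    exact hs
  change Function.Injective (FreeGroup.lift a)
  let : MulAction Λ (Fin d → ℝ) :=
    { smul := fun g v => (φ g).val *ᵥ v
      one_smul := fun v => by change (φ 1).val *ᵥ v = v; simp
      mul_smul := fun g g' v => by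
        change (φ (g * g')).val *ᵥ v = (φ g).val *ᵥ ((φ g').val *ᵥ v)
        simp }
  have hsmul : ∀ (g : Λ) (v : Fin d → ℝ), g • v = (φ g).val *ᵥ v := fun _ _ => rfl
  let U : ℕ → Set (Fin d → ℝ) := fun i => {u | ∃ t : ℝ, t ≠ 0 ∧ ‖t • u - x i‖ < r i}
  have hU : ∀ i j, i ≠ j → ∀ k : ℤ, k ≠ 0 → ∀ u ∈ U j, a i ^ k • u ∈ U i := by
    rintro i j hij k hk u ⟨t, ht, hu⟩
    obtain ⟨s, hs⟩ := ha i k hk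
    set w := t • u with hw
    have hη := hη0 i
    have hl := hlow i j hij w hu
    have hw0 : y i ⬝ᵥ w ≠ 0 := abs_pos.1 (by linarith)
    set E := s • (φ (a i ^ k)).val - vecMulVec (x i) (y i) with hE
    have hEw : ‖(y i ⬝ᵥ w)⁻¹ • E *ᵥ w‖ < r i := by
      rw [norm_smul, norm_inv, Real.norm_eq_abs]
      have h1 := norm_mulVec_le (hδ0 i).le (fun p q => (hs p q).le) w
      have h2 : |y i ⬝ᵥ w|⁻¹ ≤ (η i / 2)⁻¹ := inv_anti₀ (by positivity) hl
      have h3 := (hnorm j w hu).2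
      have h4 := hδ0 i
      calc |y i ⬝ᵥ w|⁻¹ * ‖E *ᵥ w‖ ≤ (η i / 2)⁻¹ * (d * δ i * (2 * B)) := by
            gcongr
            exact h1.trans (by gcongr)
        _ = r i * (d / (d + 1)) := by
            simp only [δ]
            field_simp
            ring
        _ < r i * 1 := by
            have : (d : ℝ) / (d + 1) < 1 := by rw [div_lt_one (by positivity)]; linarith
            exact mul_lt_mul_of_pos_left this (hr0 i)
        _ = r i := mul_one _
    have heq : ((y i ⬝ᵥ w)⁻¹ * s * t) • (a i ^ k • u) - x i = (y i ⬝ᵥ w)⁻¹ • E *ᵥ w := by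
      rw [hsmul, hE, sub_mulVec, smul_sub, vecMulVec_mulVec, hw, mulVec_smul, smul_mulVec, ← hw]
      ext p
      simp only [Pi.sub_apply, Pi.smul_apply, smul_eq_mul, MulOpposite.smul_eq_mul_unop,
        MulOpposite.unop_op]
      field_simp
    refine ⟨_, fun h0 => ?_, heq ▸ hEw⟩
    rw [h0, zero_smul, zero_sub] at heq
    rw [← heq, norm_neg] at hEw
    have := hrb i
    have := hxb i
    linarith
  have hdisj : Pairwise (Function.onFun Disjoint U) := by
    intro i j hij
    rw [Function.onFun, Set.disjoint_left]
    rintro u ⟨t, ht, hu⟩ ⟨t', ht', hu'⟩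
    have hη := hη0 i
    have h1 : |y i ⬝ᵥ (t • u)| ≤ b * η i / (16 * B) := by
      have : y i ⬝ᵥ (t • u) = y i ⬝ᵥ (t • u - x i) := by rw [dotProduct_sub, hinc, sub_zero]
      rw [this]
      exact (hyC _ _).trans ((mul_le_mul_of_nonneg_left hu.le hC.le).trans (hrC i))
    have h2 := hlow i j hij _ hu'
    have h3 := (hnorm i _ hu).1
    have h4 := (hnorm j _ hu').2
    rw [dotProduct_smul, smul_eq_mul, abs_mul] at h1 h2
    rw [norm_smul, Real.norm_eq_abs] at h3 h4
    have hu0 : 0 < ‖u‖ := by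
      rcases (norm_nonneg u).eq_or_lt with h0 | h0
      · rw [← h0, mul_zero] at h3; linarith
      · exact h0
    -- compare `|yᵢ · u| / ‖u‖`, which is small on the `i`-th cone and large on the `j`-th
    have h5 : |y i ⬝ᵥ u| * (b / 2) ≤ b * η i / (16 * B) * ‖u‖ := by
      calc |y i ⬝ᵥ u| * (b / 2) ≤ |y i ⬝ᵥ u| * (|t| * ‖u‖) := by gcongr
        _ = |t| * |y i ⬝ᵥ u| * ‖u‖ := by ring
        _ ≤ _ := by gcongr
    have h6 : η i / 2 * ‖u‖ ≤ |y i ⬝ᵥ u| * (2 * B) := by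
      calc η i / 2 * ‖u‖ ≤ |t'| * |y i ⬝ᵥ u| * ‖u‖ := by gcongr
        _ = |y i ⬝ᵥ u| * (|t'| * ‖u‖) := by ring
        _ ≤ _ := by gcongr
    have h7 : b * η i / (16 * B) * ‖u‖ * (16 * B) = b * η i * ‖u‖ := by field_simp
    have h8 := mul_le_mul_of_nonneg_right h5 (by positivity : 0 ≤ 16 * B)
    rw [h7] at h8
    have h9 := mul_le_mul_of_nonneg_right h6 (by positivity : 0 ≤ b)
    have h10 : 0 < b * η i * ‖u‖ := by positivity
    nlinarith
  let f : ∀ _ : ℕ, FreeGroup Unit →* Λ := fun i => FreeGroup.lift fun _ => a i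
  have hlift : FreeGroup.lift a =
      (Monoid.CoprodI.lift f).comp (@freeGroupEquivCoprodI ℕ).toMonoidHom := by
    ext i
    simp [f]
  rw [hlift, MonoidHom.coe_comp]
  refine Function.Injective.comp ?_ (MulEquiv.injective freeGroupEquivCoprodI)
  refine Monoid.CoprodI.lift_injective_of_ping_pong f (Or.inl ?_) U
    (fun i => ⟨x i, 1, one_ne_zero, by simpa using hr0 i⟩) hdisj ?_
  · simp
  · intro i j hij z hz
    obtain ⟨k, rfl⟩ : ∃ k : ℤ, z = FreeGroup.of () ^ k :=
      ⟨FreeGroup.freeGroupUnitEquivInt z, (FreeGroup.freeGroupUnitEquivInt.left_inv z).symm⟩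
    have hk : k ≠ 0 := by rintro rfl; exact hz (zpow_zero _)
    rintro _ ⟨u, hu, rfl⟩
    simpa [f] using hU i j hij k hk u hu

end

/-! ### A convergent sequence of incident pairs in general position -/

section

variable {n d : ℕ} {G : Subgroup (GL (Fin n) ℝ)} {ρ : G →* GL (Fin d) ℝ} {Γ : Subgroup G}

theorem ContractsTo.smul {γ : G} {K : ℤ} {x y : Fin d → ℝ} (h : ContractsTo ρ Γ γ K x y)
    (t t' : ℝ) : ContractsTo ρ Γ γ K (t • x) (t' • y) := by
  intro N hN
  have hcont : Continuous fun M : Matrix (Fin d) (Fin d) ℝ => (t * t') • M :=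
    continuous_const_smul _
  have heq : (t * t') • vecMulVec x y = vecMulVec (t • x) (t' • y) := by
    ext i j
    simp only [Matrix.smul_apply, vecMulVec_apply, Pi.smul_apply, smul_eq_mul]
    ring
  rw [← heq] at hN
  obtain ⟨b, hb, hbN⟩ := h _ (hcont.continuousAt.preimage_mem_nhds hN)
  refine ⟨b, hb, fun k hk => ?_⟩
  obtain ⟨s, hs⟩ := hbN k hk
  exact ⟨t * t' * s, by simpa only [Set.mem_preimage, smul_smul] using hs⟩

theorem mulVec_eq_smul_of_commute {A : Matrix (Fin d) (Fin d) ℝ} {x y : Fin d → ℝ} (hy : y ≠ 0)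
    (h : A * vecMulVec x y = vecMulVec x y * A) : ∃ μ : ℝ, A *ᵥ x = μ • x := by
  obtain ⟨j, hj⟩ := Function.ne_iff.1 hy
  refine ⟨(y ᵥ* A) j / y j, ?_⟩
  ext i
  rw [mul_vecMulVec, vecMulVec_mul] at h
  have hij := congrFun (congrFun h i) j
  simp only [vecMulVec_apply] at hij
  have hj' : y j ≠ 0 := hj
  simp only [Pi.smul_apply, smul_eq_mul]
  field_simp
  linarith

theorem vecMul_eq_smul_of_commute {A : Matrix (Fin d) (Fin d) ℝ} {x y : Fin d → ℝ} (hx : x ≠ 0)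
    (h : A * vecMulVec x y = vecMulVec x y * A) : ∃ μ : ℝ, y ᵥ* A = μ • y := by
  obtain ⟨i, hi⟩ := Function.ne_iff.1 hx
  refine ⟨(A *ᵥ x) i / x i, ?_⟩
  ext j
  rw [mul_vecMulVec, vecMulVec_mul] at h
  have hij := congrFun (congrFun h i) j
  simp only [vecMulVec_apply] at hij
  have hi' : x i ≠ 0 := hi
  simp only [Pi.smul_apply, smul_eq_mul]
  field_simp
  linarith

theorem map_mul_eq_of_tendsto {g b : G} (hb : Commute b g) {w : G} {c : ℕ → ℝ}
    {T : Matrix (Fin d) (Fin d) ℝ} (hw : w = g ∨ w = g⁻¹)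
    (hc : Tendsto (fun m => c m • (ρ (w ^ m)).val) atTop (𝓝 T)) :
    (ρ b).val * T = T * (ρ b).val := by
  have hbw : Commute b w := by
    rcases hw with rfl | rfl
    exacts [hb, hb.inv_right]
  refine tendsto_nhds_unique ((tendsto_const_nhds.mul hc).congr fun m => ?_)
    (hc.mul tendsto_const_nhds)
  rw [mul_smul_comm, smul_mul_assoc, ← Units.val_mul, ← Units.val_mul, ← map_mul, ← map_mul,
    (hbw.pow_right m).eq]

/-- The attracting point of `g` is an eigenline of everything commuting with `g`. -/
theorem IsAttractingData.exists_mulVec_eq {g : G} {x y' x' y : Fin d → ℝ}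
    (h : IsAttractingData ρ g x y' x' y) {b : G} (hb : Commute b g) :
    ∃ μ : ℝ, μ ≠ 0 ∧ (ρ b).val *ᵥ x = μ • x := by
  obtain ⟨c, hc⟩ := h.tendsto_pow
  obtain ⟨μ, hμ⟩ := mulVec_eq_smul_of_commute h.left_ne' (map_mul_eq_of_tendsto hb (Or.inl rfl) hc)
  refine ⟨μ, ?_, hμ⟩
  rintro rfl
  exact (h.conj b).left_ne (by rw [hμ, zero_smul])

theorem IsAttractingData.exists_vecMul_eq {g : G} {x y' x' y : Fin d → ℝ}
    (h : IsAttractingData ρ g x y' x' y) {b : G} (hb : Commute b g) :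
    ∃ μ : ℝ, μ ≠ 0 ∧ y ᵥ* (ρ b).val = μ • y := by
  obtain ⟨c, hc⟩ := h.tendsto_pow_inv
  simp only [← inv_pow] at hc
  obtain ⟨μ, hμ⟩ := vecMul_eq_smul_of_commute h.right_ne (map_mul_eq_of_tendsto hb (Or.inr rfl) hc)
  refine ⟨μ, ?_, hμ⟩
  rintro rfl
  have := (h.conj b⁻¹).right_ne'
  rw [inv_inv, hμ, zero_smul] at this
  exact this rfl

/-- The translates by sparse powers of `g` of a `G`-defined pair in general position are pairwise
transverse, and converge to the pair `(v_g, H_{g⁻¹})`. -/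
theorem IsAttractingData.exists_sequence (hG : IsZariskiConnected (G : Set (GL (Fin n) ℝ)))
    (hρ : IsRationalRep G ρ) (hirr : (linearRep ρ).IsIrreducible) {g : G} {x y' x' y : Fin d → ℝ}
    (h : IsAttractingData ρ g x y' x' y) :
    ∃ (u v : ℕ → Fin d → ℝ) (u₀ v₀ : Fin d → ℝ), Tendsto u atTop (𝓝 u₀) ∧ Tendsto v atTop (𝓝 v₀) ∧
      u₀ ≠ 0 ∧ (∀ i, u i ≠ 0) ∧ (∀ i, v i ⬝ᵥ u i = 0) ∧ (∀ i j, i ≠ j → v i ⬝ᵥ u j ≠ 0) ∧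
      (∀ i, v i ⬝ᵥ u₀ ≠ 0) ∧ (∀ i, v₀ ⬝ᵥ u i ≠ 0) ∧
      ∀ i, ∃ (t t' : ℝ) (a : G), u i = t • (ρ a).val *ᵥ x ∧ v i = t' • y ᵥ* (ρ a⁻¹).val := by
  obtain ⟨a, ha⟩ := exists_forall_ne_zero_of_regularFunctions hG (Finset.univ : Finset (Fin 4))
    ![fun a => y' ⬝ᵥ (1 * (ρ a).val) *ᵥ x, fun a => y ⬝ᵥ (1 * (ρ a).val) *ᵥ x,
      fun a => y ⬝ᵥ (1 * (ρ a⁻¹).val) *ᵥ x', fun a => y ⬝ᵥ (1 * (ρ a⁻¹).val) *ᵥ x]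
    (by
      intro i _
      fin_cases i
      · exact dotProduct_mulVec_mem_regularFunctions hρ _ _ _
      · exact dotProduct_mulVec_mem_regularFunctions hρ _ _ _
      · exact comp_inv_mem_regularFunctions (dotProduct_mulVec_mem_regularFunctions hρ _ y 1)
      · exact comp_inv_mem_regularFunctions (dotProduct_mulVec_mem_regularFunctions hρ _ y 1))
    (by
      intro i _
      fin_cases i
      · obtain ⟨b, hb⟩ := exists_dotProduct_mulVec_ne_zero hirr h.left_ne h.left_ne'
        refine ⟨b, ?_⟩
        change y' ⬝ᵥ (1 * (ρ b).val) *ᵥ x ≠ 0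
        rwa [one_mul]
      · obtain ⟨b, hb⟩ := exists_dotProduct_mulVec_ne_zero hirr h.left_ne h.right_ne'
        refine ⟨b, ?_⟩
        change y ⬝ᵥ (1 * (ρ b).val) *ᵥ x ≠ 0
        rwa [one_mul]
      · obtain ⟨b, hb⟩ := exists_dotProduct_mulVec_ne_zero hirr h.right_ne h.right_ne'
        refine ⟨b⁻¹, ?_⟩
        change y ⬝ᵥ (1 * (ρ b⁻¹⁻¹).val) *ᵥ x' ≠ 0
        rwa [one_mul, _root_.inv_inv]
      · obtain ⟨b, hb⟩ := exists_dotProduct_mulVec_ne_zero hirr h.left_ne h.right_ne'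
        refine ⟨b⁻¹, ?_⟩
        change y ⬝ᵥ (1 * (ρ b⁻¹⁻¹).val) *ᵥ x ≠ 0
        rwa [one_mul, _root_.inv_inv])
  simp only [one_mul] at ha
  set X := (ρ a).val *ᵥ x with hX
  set Y := y ᵥ* (ρ a⁻¹).val with hY
  have h1 : y' ⬝ᵥ X ≠ 0 := ha 0 (Finset.mem_univ _)
  have h2 : y ⬝ᵥ X ≠ 0 := ha 1 (Finset.mem_univ _)
  have h3 : Y ⬝ᵥ x' ≠ 0 := by rw [hY, ← dotProduct_mulVec]; exact ha 2 (Finset.mem_univ _)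
  have h4 : Y ⬝ᵥ x ≠ 0 := by rw [hY, ← dotProduct_mulVec]; exact ha 3 (Finset.mem_univ _)
  obtain ⟨c, hc⟩ := h.tendsto_pow
  obtain ⟨c', hc'⟩ := h.tendsto_pow_inv
  have hu : Tendsto (fun m => c m • (ρ (g ^ m)).val *ᵥ X) atTop (𝓝 ((y' ⬝ᵥ X) • x)) := by
    have hcont : Continuous fun T : Matrix (Fin d) (Fin d) ℝ => T *ᵥ X := by fun_prop
    have := (hcont.tendsto _).comp hc
    rw [vecMulVec_mulVec, op_smul_eq_smul] at this
    exact this.congr fun m => smul_mulVec _ _ _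
  have hv : Tendsto (fun m => c' m • Y ᵥ* (ρ (g ^ m)⁻¹).val) atTop (𝓝 ((Y ⬝ᵥ x') • y)) := by
    have hcont : Continuous fun T : Matrix (Fin d) (Fin d) ℝ => Y ᵥ* T := by fun_prop
    have := (hcont.tendsto _).comp hc'
    rw [vecMul_vecMulVec] at this
    exact this.congr fun m => vecMul_smul _ _ _
  have hpair : ∀ᶠ m in atTop, c m ≠ 0 ∧ Y ⬝ᵥ (ρ (g ^ m)).val *ᵥ X ≠ 0 := by
    have hcont : Continuous fun w : Fin d → ℝ => Y ⬝ᵥ w := continuous_const.dotProduct continuous_id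
    have hlim := (hcont.tendsto _).comp hu
    have h0 : Y ⬝ᵥ ((y' ⬝ᵥ X) • x) ≠ 0 := by
      rw [dotProduct_smul]
      exact mul_ne_zero h1 h4
    filter_upwards [hlim.eventually_ne h0] with m hm
    rw [Function.comp_apply, dotProduct_smul, smul_eq_mul] at hm
    exact mul_ne_zero_iff.1 hm
  have hpair' : ∀ᶠ m in atTop, c' m ≠ 0 ∧ Y ⬝ᵥ (ρ (g ^ m)⁻¹).val *ᵥ X ≠ 0 := by
    have hcont : Continuous fun w : Fin d → ℝ => w ⬝ᵥ X := continuous_id.dotProduct continuous_const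
    have hlim := (hcont.tendsto _).comp hv
    have h0 : ((Y ⬝ᵥ x') • y) ⬝ᵥ X ≠ 0 := by
      rw [smul_dotProduct]
      exact mul_ne_zero h3 h2
    filter_upwards [hlim.eventually_ne h0] with m hm
    rw [Function.comp_apply, smul_dotProduct, smul_eq_mul, ← dotProduct_mulVec] at hm
    exact mul_ne_zero_iff.1 hm
  obtain ⟨m₀, hm₀⟩ := eventually_atTop.1 (hpair.and hpair')
  -- pairs of distinct exponents in the sequence `ν` differ by at least `m₀`
  let ν : ℕ → ℕ := fun i => (m₀ + 1) * (i + 1)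
  have hν : ∀ i, m₀ ≤ ν i := fun i =>
    (Nat.le_succ _).trans (Nat.le_mul_of_pos_right _ (Nat.succ_pos _))
  have hνtop : Tendsto ν atTop atTop :=
    (tendsto_id.const_mul_atTop' (Nat.succ_pos m₀)).comp (tendsto_add_atTop_nat 1)
  have hνlt : ∀ i j, i < j → ∃ k, m₀ ≤ k ∧ ν j = ν i + k := by
    intro i j hij
    obtain ⟨k, rfl⟩ := Nat.exists_eq_add_of_lt hij
    exact ⟨(m₀ + 1) * (k + 1), (Nat.le_succ _).trans (Nat.le_mul_of_pos_right _ (Nat.succ_pos _)),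
      by simp only [ν]; ring⟩
  have hcomm : ∀ k : ℕ, Commute (g ^ k) g := fun k => (Commute.refl g).pow_left k
  refine ⟨_, _, _, _, hu.comp hνtop, hv.comp hνtop, smul_ne_zero h1 h.left_ne, fun i => ?_,
    fun i => ?_, fun i j hij => ?_, fun i => ?_, fun i => ?_, fun i => ?_⟩
  · refine smul_ne_zero (hm₀ _ (hν i)).1.1 fun h0 => (hm₀ _ (hν i)).1.2 ?_
    change (ρ (g ^ ν i)).val *ᵥ X = 0 at h0
    rw [h0, dotProduct_zero]
  · simp only [Function.comp_apply, smul_dotProduct, dotProduct_smul, ← dotProduct_mulVec,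
      mulVec_mulVec, ← Units.val_mul, ← map_mul, inv_mul_cancel, map_one, Units.val_one,
      one_mulVec]
    rw [show Y ⬝ᵥ X = 0 from (h.conj a).incident, smul_zero, smul_zero]
  · simp only [Function.comp_apply, smul_dotProduct, dotProduct_smul, ← dotProduct_mulVec]
    refine mul_ne_zero (hm₀ _ (hν j)).1.1 (mul_ne_zero (hm₀ _ (hν i)).2.1 ?_)
    rw [mulVec_mulVec, ← Units.val_mul, ← map_mul]
    rcases lt_or_gt_of_ne hij with hij | hij
    · obtain ⟨k, hk, hk'⟩ := hνlt i j hij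
      rw [hk', pow_add, inv_mul_cancel_left]
      exact (hm₀ k hk).1.2
    · obtain ⟨k, hk, hk'⟩ := hνlt j i hij
      rw [hk', add_comm, pow_add, show (g ^ k * g ^ ν j)⁻¹ * g ^ ν j =
        (g ^ ν j)⁻¹ * (g ^ k)⁻¹ * g ^ ν j by group, ← inv_pow g (ν j), ← inv_pow g k,
        ← pow_add, add_comm, pow_add, mul_assoc, inv_pow g (ν j), inv_mul_cancel, mul_one, inv_pow]
      exact (hm₀ k hk).2.2
  · obtain ⟨μ, hμ0, hμ⟩ := h.exists_mulVec_eq (hcomm (ν i)).inv_left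
    simp only [Function.comp_apply, smul_dotProduct, dotProduct_smul, ← dotProduct_mulVec, hμ]
    exact mul_ne_zero h1 (mul_ne_zero (hm₀ _ (hν i)).2.1 (mul_ne_zero hμ0 h4))
  · obtain ⟨μ, hμ0, hμ⟩ := h.exists_vecMul_eq (hcomm (ν i))
    simp only [Function.comp_apply, smul_dotProduct, dotProduct_smul, dotProduct_mulVec y, hμ]
    exact mul_ne_zero (hm₀ _ (hν i)).1.1 (mul_ne_zero h3 (mul_ne_zero hμ0 h2))
  · refine ⟨c (ν i), c' (ν i), g ^ ν i * a, ?_, ?_⟩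
    · simp only [Function.comp_apply, hX, mulVec_mulVec, map_mul, Units.val_mul]
    · simp only [Function.comp_apply, hY, vecMul_vecMul, ← Units.val_mul, ← map_mul]
      rw [_root_.mul_inv_rev]

/-! ### Infinite rank free subgroups meeting every conjugacy class -/

theorem not_isInvariablyGenerated_of_forall_isConj {Λ : Type*} [Group Λ] {Δ : Subgroup Λ}
    (hΔ : Δ ≠ ⊤) (h : ∀ γ : Λ, ∃ δ ∈ Δ, IsConj γ δ) : ¬ IsInvariablyGenerated Λ := by
  rintro ⟨S, hS⟩
  have h' : ∀ γ : Λ, ∃ c : Λ, c⁻¹ * γ * c ∈ Δ := by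
    intro γ
    obtain ⟨δ, hδ, hγδ⟩ := h γ
    obtain ⟨c, rfl⟩ := isConj_iff.1 hγδ
    exact ⟨c⁻¹, by simpa using hδ⟩
  choose c hc using h'
  refine hΔ (top_le_iff.1 ?_)
  rw [← hS c, Subgroup.closure_le]
  rintro _ ⟨s, -, rfl⟩
  exact hc s

/-- One of the free generators is left out to obtain a proper subgroup. -/
theorem exists_free_subgroup_ne_top {Λ : Type*} [Group Λ] {w : ℕ → Λ}
    (hw : Function.Injective (FreeGroup.lift w)) :
    ∃ Δ : Subgroup Λ, Δ ≠ ⊤ ∧ Nonempty (FreeGroup ℕ ≃* Δ) ∧ ∀ i, w (i + 1) ∈ Δ := by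
  let f : FreeGroup ℕ →* Λ := (FreeGroup.lift w).comp (FreeGroup.map Nat.succ)
  have hf : Function.Injective f := hw.comp (FreeGroup.map_injective Nat.succ_injective)
  refine ⟨f.range, fun htop => ?_, ⟨MonoidHom.ofInjective hf⟩,
    fun i => ⟨FreeGroup.of i, by simp [f]⟩⟩
  obtain ⟨z, hz⟩ : w 0 ∈ f.range := htop ▸ Subgroup.mem_top _
  have hz' : FreeGroup.map Nat.succ z = FreeGroup.of 0 := hw (by simpa [f] using hz)
  -- the homomorphism to `ℤ` that only counts the generator left out
  let q : FreeGroup ℕ →* Multiplicative ℤ :=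
    FreeGroup.lift fun i => if i = 0 then Multiplicative.ofAdd 1 else 1
  have hq : q.comp (FreeGroup.map Nat.succ) = 1 := by
    ext i
    simp [q]
  have h0 : q (FreeGroup.of 0) = 1 := by
    rw [← hz']
    exact DFunLike.congr_fun hq z
  simp [q] at h0

/-- A lattice element approximating the rank one limit of `g ^ m` is not scalar. -/
theorem exists_mem_lattice_ne_one (hd : 2 ≤ d) (hρ : IsRationalRep G ρ)
    (hΓ : IsLatticeSubgroup Γ) {g : G} {x y' x' y : Fin d → ℝ}
    (h : IsAttractingData ρ g x y' x' y) : ∃ γ ∈ Γ, γ ≠ 1 := by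
  have hclosed : IsClosed ((Submodule.span ℝ {(1 : Matrix (Fin d) (Fin d) ℝ)} :
      Submodule ℝ (Matrix (Fin d) (Fin d) ℝ)) : Set (Matrix (Fin d) (Fin d) ℝ)) :=
    Submodule.closed_of_finiteDimensional _
  obtain ⟨γ, hγ, s, s', hs⟩ := h.exists_mem_lattice hρ hΓ
    (continuous_fst.continuousAt.preimage_mem_nhds (hclosed.isOpen_compl.mem_nhds fun hmem => by
      obtain ⟨t, ht⟩ := Submodule.mem_span_singleton.1 hmem
      exact vecMulVec_ne_smul_one hd h.left_ne h.left_ne' t ht.symm))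
  refine ⟨γ, hγ, ?_⟩
  rintro rfl
  apply hs
  simpa using Submodule.smul_mem _ s (Submodule.mem_span_singleton_self _)

end

theorem theorem2p2 (n d : ℕ) (hd : 2 ≤ d)
    (G : Subgroup (GL (Fin n) ℝ))
    (hGclosed : IsZariskiClosed (G : Set (GL (Fin n) ℝ)))
    (hGconn : IsZariskiConnected (G : Set (GL (Fin n) ℝ)))
    (ρ : G →* GL (Fin d) ℝ)
    (hρrational : IsRationalRep G ρ)
    (hρfaithful : Function.Injective ρ)
    (hρirred : (linearRep ρ).IsIrreducible)
    (hpairs : ¬ ∃ X : Set (ℙ ℝ (Fin d → ℝ) × ℙ ℝ (Fin d → ℝ)),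
      IsIncidentSubvariety X ∧ X ≠ incidentPairs d ∧ definedIncidentPairs ρ.range ⊆ X)
    (Γ : Subgroup G)
    (hΓlattice : IsLatticeSubgroup Γ)
    (hΓregular : ∀ γ ∈ Γ, γ ≠ 1 → IsRegularElt (ρ γ)) :
    (∃ Δ : Subgroup Γ,
      (∃ X : Type, Infinite X ∧ Nonempty (FreeGroup X ≃* Δ)) ∧
      ∀ γ : Γ, ∃ δ ∈ Δ, IsConj γ δ) ∧
    ¬ IsInvariablyGenerated Γ := by

  have : NeZero d := ⟨by omega⟩
  obtain ⟨p, hp, -⟩ := exists_mem_definedIncidentPairs hpairs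
    (M := vecMulVec (Pi.single 0 1) (Pi.single 0 1)) (vecMulVec_ne_smul_one hd (by simp) (by simp))
  obtain ⟨g, y', x', hdata⟩ := exists_isAttractingData hp
  have hcontr : ∀ γ ∈ Γ, γ ≠ 1 → ∀ a : G,
      ContractsTo ρ Γ γ 1 ((ρ a).val *ᵥ p.1.rep) (p.2.rep ᵥ* (ρ a⁻¹).val) := fun γ hγ hγ1 a =>
    (hdata.conj a).contractsTo hd hGconn hρrational hρirred hpairs hΓlattice
      ((hΓregular γ hγ hγ1).hasNonscalarLimit hd).1 ((hΓregular γ hγ hγ1).hasNonscalarLimit hd).2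
  obtain ⟨u, v, u₀, v₀, hu, hv, hu₀, hu0, hinc, hne, hlim, hlim', hpair⟩ :=
    hdata.exists_sequence hGconn hρrational hρirred
  have : DiscreteTopology Γ := hΓlattice.1
  have : Countable Γ := TopologicalSpace.separableSpace_iff_countable.1 inferInstance
  obtain ⟨γ₀, hγ₀, hγ₀1⟩ := exists_mem_lattice_ne_one hd hρrational hΓlattice hdata
  have : Nonempty {γ : Γ // γ ≠ 1} := ⟨⟨⟨γ₀, hγ₀⟩, fun h => hγ₀1 (congrArg Subtype.val h)⟩⟩
  obtain ⟨e, he⟩ := exists_surjective_nat {γ : Γ // γ ≠ 1}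
  -- the class indexed by `0` is visited twice, so that its first generator can be left out
  obtain ⟨c, hc⟩ := exists_injective_lift_of_contracting (ρ.comp Γ.subtype) hu hv hu₀ hu0 hinc hne
    hlim hlim' (fun i => (e (i - 1)).1) (by
      intro i N hN
      obtain ⟨t, t', a, hut, hvt⟩ := hpair i
      rw [hut, hvt] at hN
      obtain ⟨b, hb, hbN⟩ := (hcontr (e (i - 1)).1.1 (e (i - 1)).1.2
        (fun h => (e (i - 1)).2 (Subtype.ext h)) a).smul t t' N hN
      exact ⟨⟨b, hb⟩, fun k hk => hbN k (Int.one_le_abs hk)⟩)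
  obtain ⟨Δ, hΔtop, hΔfree, hΔ⟩ := exists_free_subgroup_ne_top hc
  have hconj : ∀ γ : Γ, ∃ δ ∈ Δ, IsConj γ δ := by
    intro γ
    by_cases hγ : γ = 1
    · exact ⟨1, one_mem _, hγ ▸ IsConj.refl _⟩
    · obtain ⟨i, hi⟩ := he ⟨γ, hγ⟩
      refine ⟨_, hΔ i, isConj_iff.2 ⟨c (i + 1), ?_⟩⟩
      rw [Nat.add_sub_cancel, hi]
  exact ⟨⟨Δ, ⟨ℕ, inferInstance, hΔfree⟩, hconj⟩,
    not_isInvariablyGenerated_of_forall_isConj hΔtop hconj⟩
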